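/- For an integer $k\ge 1$ put $N(k)=4k(4k+1)$ and $Q(z)=z^{4k}-(-4)^k$. Take unknowns $a(1),\dots,a(N(k)+4k)$ and put $$\check R(z)=\sum_{j=1}^{N(k)-1}a(j)z^j,\qquad S_k(n)=\sum_{j=0}^{4k}a(N(k)+j)\,n^j .$$ Let $T(y)$ be the polynomial (of degree at most $4k+1$) with $$\sum_{n\ge 0}(8kn+1)S_k(n)y^n=\frac{T(y)}{(1-y)^{4k+2}},$$ and let $P(z)$ be the polynomial with $\dfrac{T(y)}{(1-y)^{4k+2}}=\dfrac{P(z)}{Q(z)^{4k+2}}$ for $y=z^{4k}/(-4)^k$, that is, $P(z)=\big(-(-4)^k\big)^{4k+2}\,T\big(z^{4k}/(-4)^k\big)$. Substitute these into the differential equation $$-(1-4z)Q\frac{d\check R}{dz}+\big(2Q+4k(4k+1)(1-4z)z^{4k-1}\big)\check R-P+2(3-2z)\frac{Q^{4k+2}}{z^2-2z+2}=0 ,$$ whose left-hand side is a polynomial in $z$ of degree less than $N(k)+4k$. Comparing the coefficients of $z^0,z^1,\dots,z^{N(k)+4k-1}$ gives a system of $N(k)+4k$ linear equations in the $N(k)+4k$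 unknowns. Let $A(k)$ be its coefficient matrix: the row with index $i$ ($0\le i<N(k)+4k$) holds the coefficients of $a(1),\dots,a(N(k)+4k)$, in this order, in the coefficient of $z^i$ of the left-hand side. Then for all $k\ge1$ $$\det A(k)=(-1)^{k-1}\,2^{32k^3+32k^2+2k-1}\,k^{8k^2+2k}\,\big((4k+1)!\big)^{4k}\,\frac{(8k)!}{(4k)!}\,\prod_{j=1}^{4k}\frac{(2j)!}{j!}.$$ In particular, $\det A(k)\neq 0$ for all $k\ge 1$. -/

import Mathlib

open Polynomial

noncomputable section

namespace PiFormula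

/-- The number `N(k) = 4k(4k+1)`. -/
def N (k : ℕ) : ℕ := 4 * k * (4 * k + 1)

/-- The polynomial `Q(z) = z^(4k) - (-4)^k`, where `z = x(1-x)`. -/
def Q (k : ℕ) : ℚ[X] := X ^ (4 * k) - C ((-4) ^ k)

/-- The first Ansatz: `Ř(z) = ∑_{j=1}^{N(k)-1} a(j) z^j`. -/
def Rcheck (k : ℕ) (a : ℕ → ℚ) : ℚ[X] := ∑ j ∈ Finset.Ico 1 (N k), C (a j) * X ^ j

/-- The second Ansatz: `S_k(n) = ∑_{j=0}^{4k} a(N(k)+j) n^j`. -/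
def S (k : ℕ) (a : ℕ → ℚ) : ℚ[X] := ∑ j ∈ Finset.range (4 * k + 1), C (a (N k + j)) * X ^ j

/-- The generating function `∑_{n ≥ 0} (8kn+1) S(n) y^n` of a polynomial `S`. -/
def genFun (k : ℕ) (s : ℚ[X]) : PowerSeries ℚ :=
  PowerSeries.mk fun n => (8 * (k : ℚ) * n + 1) * s.eval (n : ℚ)

/-- The numerator `T(y)` of the generating function of a polynomial `S` of degree at most `4k`:
`∑_{n ≥ 0} (8kn+1) S(n) y^n = T(y) / (1-y)^(4k+2)`. The product
`(1-y)^(4k+2) * ∑_{n ≥ 0} (8kn+1) S(n) y^n` is a polynomial of degree at most `4k+1`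
(see `coe_T`), so that truncating it after `y^(4k+1)` only turns it into a polynomial. -/
def T (k : ℕ) (s : ℚ[X]) : ℚ[X] :=
  PowerSeries.trunc (4 * k + 2) ((1 - PowerSeries.X) ^ (4 * k + 2) * genFun k s)

/-- The polynomial `P(z)` with `T(y) / (1-y)^(4k+2) = P(z) / Q(z)^(4k+2)` at
`y = z^(4k) / (-4)^k` (see `P_spec`). -/
def P (k : ℕ) (s : ℚ[X]) : ℚ[X] :=
  C ((-(-4) ^ k) ^ (4 * k + 2)) * (T k s).comp (C (((-4) ^ k)⁻¹) * X ^ (4 * k))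

/-- The left-hand side of the differential equation
`-(1-4z) Q Ř' + (2Q + 4k(4k+1)(1-4z) z^(4k-1)) Ř - P + 2(3-2z) Q^(4k+2) / (z²-2z+2) = 0`
after substitution of the two Ansätze. The division by `z²-2z+2` is exact (see `dvd_Q`). -/
def diffEq (k : ℕ) (a : ℕ → ℚ) : ℚ[X] :=
  -(1 - 4 * X) * Q k * derivative (Rcheck k a)
    + (2 * Q k + C (4 * (k : ℚ) * (4 * k + 1)) * (1 - 4 * X) * X ^ (4 * k - 1)) * Rcheck k a
    - P k (S k a)
    + 2 * (3 - 2 * X) * (Q k ^ (4 * k + 2) / (X ^ 2 - 2 * X + 2))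

/-- The coefficient matrix `A(k)` of the system of `N(k)+4k` linear equations in the `N(k)+4k`
unknowns `a(1), …, a(N(k)+4k)` that results from comparing coefficients of
`z^0, …, z^(N(k)+4k-1)` in the differential equation. The row with index `i` belongs to `z^i`, the
column with index `j` to the unknown `a(j+1)`. As `diffEq k a` is an affine function of `a`, the
coefficient of an unknown is the change of the left-hand side when this unknown is raised from `0`
to `1` (see `diffEq_eq_zero_iff` for the resulting system). -/
def A (k : ℕ) : Matrix (Fin (N k + 4 * k)) (Fin (N k + 4 * k)) ℚ :=
  Matrix.of fun i j =>
    (diffEq k (Pi.single ((j : ℕ) + 1) 1)).coeff i - (diffEq k 0).coeff i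

theorem dvd_Q (k : ℕ) : (X ^ 2 - 2 * X + 2 : ℚ[X]) ∣ Q k := by
  have h : (X ^ 4 - (-4) : ℚ[X]) ∣ (X ^ 4) ^ k - (-4) ^ k := sub_dvd_pow_sub_pow _ _ k
  have e : Q k = (X ^ 4) ^ k - (-4) ^ k := by
    have h4 : (C (-4 : ℚ) : ℚ[X]) = -4 := by rw [map_neg]; rfl
    rw [Q, pow_mul, C_pow, h4]
  rw [e]
  exact dvd_trans ⟨X ^ 2 + 2 * X + 2, by ring⟩ h

theorem natDegree_S_le (k : ℕ) (a : ℕ → ℚ) : (S k a).natDegree ≤ 4 * k := by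
  refine natDegree_sum_le_of_forall_le _ _ fun j hj => ?_
  exact (natDegree_C_mul_X_pow_le _ _).trans (by simp at hj; omega)

theorem coeff_one_sub_pow_mul (f : ℚ → ℚ) (D n : ℕ) :
    PowerSeries.coeff (n + D) ((1 - PowerSeries.X) ^ D * PowerSeries.mk fun m => f (m : ℚ))
      = (fwdDiff 1)^[D] f (n : ℚ) := by
  induction D generalizing n with
  | zero => simp
  | succ D ih =>
    rw [pow_succ', mul_assoc, sub_mul, one_mul, map_sub, Function.iterate_succ_apply', fwdDiff,
      ← add_assoc, PowerSeries.coeff_succ_X_mul, ih, add_right_comm, ih]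
    push_cast
    rfl

/-- `T(y) = (1-y)^(4k+2) * ∑_{n ≥ 0} (8kn+1) S(n) y^n` if `S` has degree at most `4k`. -/
theorem coe_T (k : ℕ) (s : ℚ[X]) (hs : s.natDegree ≤ 4 * k) :
    (T k s : PowerSeries ℚ) = (1 - PowerSeries.X) ^ (4 * k + 2) * genFun k s := by
  have hg : genFun k s
      = PowerSeries.mk fun n => (fun x : ℚ => ((C (8 * (k : ℚ)) * X + 1) * s).eval x) (n : ℚ) := by
    simp [genFun]
  have hd : ((C (8 * (k : ℚ)) * X + 1) * s).natDegree < 4 * k + 2 := by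
    have h1 : (C (8 * (k : ℚ)) * X + 1 : ℚ[X]).natDegree ≤ 1 := by compute_degree
    have := natDegree_mul_le (p := C (8 * (k : ℚ)) * X + 1) (q := s)
    omega
  ext n
  rw [coeff_coe, T, PowerSeries.coeff_trunc]
  split_ifs with h
  · rfl
  · obtain ⟨m, rfl⟩ : ∃ m, n = m + (4 * k + 2) := ⟨n - (4 * k + 2), by omega⟩
    have h1 := coeff_one_sub_pow_mul
      (fun x : ℚ => ((C (8 * (k : ℚ)) * X + 1) * s).eval x) (4 * k + 2) m
    have h2 := congrFun (Polynomial.fwdDiff_iter_eq_zero_of_degree_lt hd) (m : ℚ)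
    rw [hg]
    exact (h1.trans h2).symm

/-- `P(z) / Q(z)^(4k+2) = T(y) / (1-y)^(4k+2)` at `y = z^(4k) / (-4)^k`. -/
theorem P_spec (k : ℕ) (s : ℚ[X]) :
    P k s * (1 - C (((-4) ^ k)⁻¹) * X ^ (4 * k)) ^ (4 * k + 2)
      = (T k s).comp (C (((-4) ^ k)⁻¹) * X ^ (4 * k)) * Q k ^ (4 * k + 2) := by
  have h : Q k = C (-(-4) ^ k) * (1 - C (((-4) ^ k)⁻¹) * X ^ (4 * k)) := by
    have h0 : ((-4 : ℚ) ^ k) ≠ 0 := by positivity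
    rw [mul_sub, ← mul_assoc, ← C_mul, neg_mul, mul_inv_cancel₀ h0, Q]
    simp only [map_neg, map_one]
    ring
  rw [h, mul_pow, P, ← C_pow]
  ring

theorem T_add (k : ℕ) (s t : ℚ[X]) : T k (s + t) = T k s + T k t := by
  have : genFun k (s + t) = genFun k s + genFun k t := by
    ext n; simp [genFun, mul_add]
  rw [T, this, mul_add, map_add]; rfl

theorem T_C_mul (k : ℕ) (c : ℚ) (s : ℚ[X]) : T k (C c * s) = C c * T k s := by
  have : genFun k (C c * s) = PowerSeries.C c * genFun k s := by
    ext n; simp [genFun]; ring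
  ext n
  rw [T, this, mul_left_comm, PowerSeries.coeff_trunc, coeff_C_mul, T, PowerSeries.coeff_trunc]
  split_ifs <;> simp

/-- The part of `diffEq` that depends on the unknowns. -/
def linPart (k : ℕ) : (ℕ → ℚ) →ₗ[ℚ] ℚ[X] where
  toFun a := diffEq k a - diffEq k 0
  map_add' a b := by
    have hR : Rcheck k (a + b) = Rcheck k a + Rcheck k b := by
      simp [Rcheck, add_mul, Finset.sum_add_distrib]
    have hS : S k (a + b) = S k a + S k b := by
      simp [S, add_mul, Finset.sum_add_distrib]
    have hR0 : Rcheck k 0 = 0 := by simp [Rcheck]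
    have hS0 : S k 0 = 0 := by simp [S]
    have hT0 : T k 0 = 0 := by simpa using T_C_mul k 0 0
    simp only [diffEq, hR, hS, hR0, hS0, P, T_add, hT0, add_comp, zero_comp, derivative_add,
      derivative_zero]
    ring
  map_smul' c a := by
    have hR : Rcheck k (c • a) = C c * Rcheck k a := by
      simp [Rcheck, Finset.mul_sum, mul_assoc]
    have hS : S k (c • a) = C c * S k a := by
      simp [S, Finset.mul_sum, mul_assoc]
    have hR0 : Rcheck k 0 = 0 := by simp [Rcheck]
    have hS0 : S k 0 = 0 := by simp [S]
    have hT0 : T k 0 = 0 := by simpa using T_C_mul k 0 0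
    simp only [diffEq, hR, hS, hR0, hS0, P, T_C_mul, hT0, mul_comp, C_comp, zero_comp,
      derivative_C_mul, derivative_zero, RingHom.id_apply, smul_eq_C_mul]
    ring

theorem diffEq_congr (k : ℕ) (hk : 1 ≤ k) (a b : ℕ → ℚ)
    (h : ∀ m, 1 ≤ m → m ≤ N k + 4 * k → a m = b m) : diffEq k a = diffEq k b := by
  have hN : 1 ≤ N k := Nat.mul_pos (by omega) (by omega)
  have hR : Rcheck k a = Rcheck k b :=
    Finset.sum_congr rfl fun j hj => by
      rw [Finset.mem_Ico] at hj
      rw [h j hj.1 (by omega)]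
  have hS : S k a = S k b :=
    Finset.sum_congr rfl fun j hj => by
      rw [Finset.mem_range] at hj
      rw [h (N k + j) (by omega) (by omega)]
  rw [diffEq, diffEq, hR, hS]

/-- The `i`-th coefficient of the left-hand side is an affine function of the unknowns, with linear
part given by the `i`-th row of `A(k)`. -/
theorem coeff_diffEq (k : ℕ) (hk : 1 ≤ k) (a : ℕ → ℚ) (i : Fin (N k + 4 * k)) :
    (diffEq k a).coeff i
      = (A k).mulVec (fun j => a ((j : ℕ) + 1)) i + (diffEq k 0).coeff i := by
  have hloc : diffEq k a
      = diffEq k (∑ j : Fin (N k + 4 * k), a ((j : ℕ) + 1) • Pi.single ((j : ℕ) + 1) (1 : ℚ)) := by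
    refine diffEq_congr k hk _ _ fun m h1 h2 => ?_
    rw [Finset.sum_apply, Finset.sum_eq_single (⟨m - 1, by omega⟩ : Fin (N k + 4 * k))]
    · simp [Nat.sub_add_cancel h1]
    · intro j _ hj
      have : m ≠ (j : ℕ) + 1 := fun h => hj (Fin.ext (by simp; omega))
      simp [this]
    · simp
  have hl := map_sum (linPart k)
    (fun j : Fin (N k + 4 * k) => a ((j : ℕ) + 1) • Pi.single ((j : ℕ) + 1) (1 : ℚ)) Finset.univ
  simp only [map_smul] at hl
  have hd : ∀ b, linPart k b = diffEq k b - diffEq k 0 := fun _ => rfl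
  rw [hd, ← hloc, sub_eq_iff_eq_add] at hl
  rw [hl, coeff_add, finsetSum_coeff]
  congr 1
  refine Finset.sum_congr rfl fun j _ => ?_
  rw [coeff_smul, hd, coeff_sub, smul_eq_mul, mul_comm]
  rfl

theorem natDegree_diffEq_lt (k : ℕ) (hk : 1 ≤ k) (a : ℕ → ℚ) :
    (diffEq k a).natDegree < N k + 4 * k := by
  have hN : N k = 4 * k * (4 * k + 1) := rfl
  have hN1 : 20 ≤ N k := by rw [hN]; nlinarith
  have hQ : (Q k).natDegree ≤ 4 * k := by rw [Q]; compute_degree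
  have hR : (Rcheck k a).natDegree ≤ N k - 1 := by
    refine natDegree_sum_le_of_forall_le _ _ fun j hj => ?_
    exact (natDegree_C_mul_X_pow_le _ _).trans (by simp at hj; omega)
  have hR' : (derivative (Rcheck k a)).natDegree ≤ N k - 2 :=
    (natDegree_derivative_le _).trans (by omega)
  have hX : (1 - 4 * X : ℚ[X]).natDegree ≤ 1 := by compute_degree
  have h1 : (-(1 - 4 * X) * Q k * derivative (Rcheck k a)).natDegree ≤ 1 + 4 * k + (N k - 2) := by
    refine natDegree_mul_le_of_le (natDegree_mul_le_of_le ?_ hQ) hR'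
    rwa [natDegree_neg]
  have h2 : ((2 * Q k + C (4 * (k : ℚ) * (4 * k + 1)) * (1 - 4 * X) * X ^ (4 * k - 1))
      * Rcheck k a).natDegree ≤ 4 * k + (N k - 1) := by
    refine natDegree_mul_le_of_le (natDegree_add_le_of_degree_le ?_ ?_) hR
    · exact (natDegree_mul_le_of_le (natDegree_ofNat 2).le hQ).trans (by omega)
    · refine (natDegree_mul_le_of_le (natDegree_mul_le_of_le (natDegree_C _).le hX)
        (natDegree_X_pow_le _)).trans (by omega)
  have h3 : (P k (S k a)).natDegree ≤ N k := by
    have hT : (T k (S k a)).natDegree ≤ 4 * k + 1 :=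
      Nat.lt_succ_iff.mp (PowerSeries.natDegree_trunc_lt _ _)
    rw [P]
    refine (natDegree_C_mul_le _ _).trans (natDegree_comp_le.trans ?_)
    rw [hN, mul_comm (4 * k)]
    exact Nat.mul_le_mul hT (natDegree_C_mul_X_pow_le _ _)
  have h4 : (2 * (3 - 2 * X) * (Q k ^ (4 * k + 2) / (X ^ 2 - 2 * X + 2)) : ℚ[X]).natDegree
      ≤ 0 + 1 + ((4 * k + 2) * (4 * k) - 2) := by
    have h32 : (3 - 2 * X : ℚ[X]).natDegree ≤ 1 := by compute_degree
    have hq : (X ^ 2 - 2 * X + 2 : ℚ[X]).natDegree = 2 := by compute_degree!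
    refine natDegree_mul_le_of_le (natDegree_mul_le_of_le (natDegree_ofNat 2).le h32) ?_
    have hq0 : (X ^ 2 - 2 * X + 2 : ℚ[X]) ≠ 0 := fun h => by simp [h] at hq
    obtain ⟨c, hc⟩ : (X ^ 2 - 2 * X + 2 : ℚ[X]) ∣ Q k ^ (4 * k + 2) :=
      (dvd_Q k).trans (dvd_pow_self _ (by omega))
    have hp : (Q k ^ (4 * k + 2)).natDegree ≤ (4 * k + 2) * (4 * k) :=
      natDegree_pow_le_of_le _ hQ
    rw [hc] at hp ⊢
    rw [mul_div_cancel_left₀ _ hq0]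
    by_cases hc0 : c = 0
    · simp [hc0]
    · rw [natDegree_mul hq0 hc0, hq] at hp
      omega
  have e : (4 * k + 2) * (4 * k) = N k + 4 * k := by rw [hN]; ring
  rw [e] at h4
  have h := (natDegree_add_le_of_degree_le (n := N k + 4 * k - 1) ((natDegree_sub_le_of_le
    (natDegree_add_le_of_degree_le (n := N k + 4 * k - 1) (h1.trans (by omega))
      (h2.trans (by omega))) (h3.trans (show N k ≤ N k + 4 * k - 1 by omega))).trans (max_self _).le) (h4.trans (by omega)))
  rw [diffEq]
  omega

/-- The differential equation holds if and only if the unknowns solve the linear system with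
coefficient matrix `A(k)`. -/
theorem diffEq_eq_zero_iff (k : ℕ) (hk : 1 ≤ k) (a : ℕ → ℚ) :
    diffEq k a = 0 ↔
      (A k).mulVec (fun j => a ((j : ℕ) + 1)) = fun i : Fin (N k + 4 * k) => -(diffEq k 0).coeff i := by
  constructor
  · intro h
    ext i
    have := coeff_diffEq k hk a i
    rw [h, coeff_zero] at this
    linarith
  · intro h
    ext n
    rw [coeff_zero]
    by_cases hn : n < N k + 4 * k
    · have := coeff_diffEq k hk a ⟨n, hn⟩
      rw [h] at this
      simpa using this
    · exact coeff_eq_zero_of_natDegree_lt (by have := natDegree_diffEq_lt k hk a; omega)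

end PiFormula
end

/-! Put M = 4k and c = (-4)^k, so that Q = z^M - c. With Ř = Q^(M+1) f the term
4k(4k+1)(1-4z)z^(4k-1) Ř cancels the derivative of Q^(M+1), and the linear part of the equation
becomes Q^(M+2) times (4z-1)f' + 2f - ∑ (2Mn+1) S(n) c^(-n) z^(Mn) (`coe_linPart`). If f has
coefficients c^(-t) F_j(t) at z^(Mt+j) with all F_j of degree at most M, then Q^(M+1) f is a
polynomial of degree less than N(k). So A(k) amounts to a map from the tuples (F_0, ..., F_(M-1),
S), with F_0(0) = 0, to M residue components of degree at most M+1; multiplication by powers of Q is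
triangular and contributes only powers of -c.

Both sides are expanded in Newton polynomials for the nodes -(2s+1)/(2M), the zeros in t of 4m+2 at
m = Mt+s. As the coefficient of (4z-1)f' + 2f at z^m is (4m+2)f_m - (m+1)f_(m+1), a column has at
most four nonzero entries, and the choice of nodes annihilates the one entry that would spoil
triangularity. What remains, `coreMatrix`, is triangular up to the row permutation `matching`, which
has sign -1, so its determinant is an explicit product (`coreEntry_weight`, `det_coreMatrix`).

Going from coefficients to values costs nearly the same factorials in the domain and in the image;
only those at t = M+1 survive and give ((4k+1)!)^(4k) (`det_newtonValues_eq`). The odd factors of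
the core entries assemble to the quotients (2j)!/j!. -/

namespace PiFormula

/-! ### Series with quasi-polynomial coefficients. -/

/-- The power series whose coefficient of `z^(M t + r)` with `r < M` is `c^(-t) F_r(t)`. -/
noncomputable def quasiSeries (M : ℕ) (c : ℚ) (F : ℕ → ℚ → ℚ) : PowerSeries ℚ :=
  PowerSeries.mk fun m => c⁻¹ ^ (m / M) * F (m % M) ((m / M : ℕ) : ℚ)

theorem coeff_quasiSeries (M : ℕ) (c : ℚ) (F : ℕ → ℚ → ℚ) (t r : ℕ) (hr : r < M) :
    PowerSeries.coeff (M * t + r) (quasiSeries M c F) = c⁻¹ ^ t * F r t := by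
  rw [quasiSeries, PowerSeries.coeff_mk, Nat.mul_add_div (by omega), Nat.div_eq_of_lt hr,
    Nat.mul_add_mod, Nat.mod_eq_of_lt hr, add_zero]

/-- Shifting by M replaces t by t-1 and costs a factor c, so z^M - c acts as minus the forward
difference on each component. The truncation accounts for the first M coefficients, which have no
predecessor. -/
theorem sub_mul_quasiSeries {M : ℕ} (hM : 0 < M) {c : ℚ} (hc : c ≠ 0) (F : ℕ → ℚ → ℚ) :
    (PowerSeries.X ^ M - PowerSeries.C c) * quasiSeries M c F
      = PowerSeries.X ^ M * quasiSeries M c (fun r => -fwdDiff 1 (F r))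
        - PowerSeries.C c * ((PowerSeries.trunc M (quasiSeries M c F) : ℚ[X]) : PowerSeries ℚ) := by
  ext m
  rw [sub_mul, map_sub, map_sub, PowerSeries.coeff_X_pow_mul', PowerSeries.coeff_X_pow_mul',
    PowerSeries.coeff_C_mul, PowerSeries.coeff_C_mul, coeff_coe, PowerSeries.coeff_trunc]
  by_cases h : M ≤ m
  · rw [if_pos h, if_pos h, if_neg (by omega)]
    obtain ⟨t, r, hr, rfl⟩ : ∃ t r, r < M ∧ m = M * (t + 1) + r := by
      refine ⟨m / M - 1, m % M, Nat.mod_lt _ hM, ?_⟩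
      rw [Nat.sub_add_cancel (Nat.div_pos h hM), Nat.div_add_mod]
    have e : M * (t + 1) + r - M = M * t + r := by rw [mul_add, mul_one]; omega
    rw [e, coeff_quasiSeries _ _ _ _ _ hr, coeff_quasiSeries _ _ _ _ _ hr,
      coeff_quasiSeries _ _ _ _ _ hr]
    simp only [Pi.neg_apply, fwdDiff]
    push_cast
    rw [pow_succ]
    linear_combination -(c⁻¹ ^ t * F r (t + 1)) * mul_inv_cancel₀ hc
  · rw [if_neg h, if_neg h, if_pos (by omega)]

theorem fwdDiff_iterate_neg (D : ℕ) (f : ℚ → ℚ) :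
    (fwdDiff 1)^[D] (-f) = -(fwdDiff 1)^[D] f := by
  have := fwdDiff_iter_const_smul (1 : ℚ) (-1 : ℚ) f D
  simpa using this

/-- If the `F_r` are annihilated by the `D`-th difference, then `(z^M - c)^D` times the series is
a polynomial of degree less than `D M`. -/
theorem coeff_pow_mul_quasiSeries_eq_zero {M : ℕ} (hM : 0 < M) {c : ℚ} (hc : c ≠ 0) (D : ℕ)
    (F : ℕ → ℚ → ℚ) (hF : ∀ r, (fwdDiff 1)^[D] (F r) = 0) (m : ℕ) (hm : D * M ≤ m) :
    PowerSeries.coeff m ((PowerSeries.X ^ M - PowerSeries.C c) ^ D * quasiSeries M c F) = 0 := by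
  induction D generalizing F m with
  | zero =>
    simp only [Function.iterate_zero, id_eq] at hF
    simp [quasiSeries, hF]
  | succ D ih =>
    rw [add_mul, one_mul] at hm
    rw [pow_succ, mul_assoc, sub_mul_quasiSeries hM hc, mul_sub, map_sub, mul_left_comm,
      PowerSeries.coeff_X_pow_mul', if_pos (by omega), ih _ _ _ (by omega), zero_sub, neg_eq_zero]
    · have e : (PowerSeries.X ^ M - PowerSeries.C c) ^ D
          * (PowerSeries.C c * ((PowerSeries.trunc M (quasiSeries M c F) : ℚ[X]) : PowerSeries ℚ))
          = (((X ^ M - C c) ^ D * (C c * PowerSeries.trunc M (quasiSeries M c F)) : ℚ[X]) :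
            PowerSeries ℚ) := by
        push_cast
        rfl
      rw [e, coeff_coe]
      apply coeff_eq_zero_of_natDegree_lt
      have h1 : ((X ^ M - C c : ℚ[X]) ^ D).natDegree ≤ D * M :=
        natDegree_pow_le_of_le _ (by compute_degree)
      have h2 : (C c * PowerSeries.trunc M (quasiSeries M c F)).natDegree ≤ M - 1 := by
        refine (natDegree_C_mul_le _ _).trans ?_
        obtain ⟨n, rfl⟩ : ∃ n, M = n + 1 := ⟨M - 1, by omega⟩
        exact Nat.lt_succ_iff.mp (PowerSeries.natDegree_trunc_lt _ _)
      have := natDegree_mul_le_of_le h1 h2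
      omega
    · intro r
      have h := hF r
      rw [Function.iterate_succ_apply] at h
      rw [fwdDiff_iterate_neg, h, neg_zero]

/-! ### The linear part of the equation divided by Q^(4k+2). -/

theorem coe_Q (k : ℕ) :
    (Q k : PowerSeries ℚ) = PowerSeries.X ^ (4 * k) - PowerSeries.C ((-4) ^ k) := by
  rw [Q]
  push_cast
  simp

/-- The substitution of `c⁻¹ z^M` into a power series. -/
noncomputable def substPow (M : ℕ) (hM : M ≠ 0) (c : ℚ) : PowerSeries ℚ →+* PowerSeries ℚ :=
  (PowerSeries.expand M hM : PowerSeries ℚ →ₐ[ℚ] PowerSeries ℚ).toRingHom.comp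
    (PowerSeries.rescale c⁻¹)

theorem substPow_coe (M : ℕ) (hM : M ≠ 0) (c : ℚ) (p : ℚ[X]) :
    substPow M hM c p = (p.comp (C c⁻¹ * X ^ M) : ℚ[X]) := by
  have h : (substPow M hM c).comp (Polynomial.coeToPowerSeries.ringHom (R := ℚ))
      = (Polynomial.coeToPowerSeries.ringHom (R := ℚ)).comp
        (Polynomial.compRingHom (C c⁻¹ * X ^ M)) := by
    refine Polynomial.ringHom_ext (fun a => ?_) ?_
    · have h : PowerSeries.rescale c⁻¹ (PowerSeries.C a) = PowerSeries.C a := by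
        ext n
        rw [PowerSeries.coeff_rescale, PowerSeries.coeff_C]
        split_ifs with hn <;> simp [hn]
      simp [substPow, h, PowerSeries.expand_C]
    · simp [substPow, PowerSeries.rescale_X, PowerSeries.expand_C, PowerSeries.expand_X]
  exact congrArg (fun f => f p) h

theorem substPow_mk (M : ℕ) (hM : M ≠ 0) (c : ℚ) (f : ℚ → ℚ) :
    substPow M hM c (PowerSeries.mk fun n => f n)
      = quasiSeries M c (fun r => if r = 0 then f else 0) := by
  ext m
  simp only [substPow, RingHom.comp_apply, AlgHom.toRingHom_eq_coe, RingHom.coe_coe,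
    PowerSeries.coeff_expand, PowerSeries.coeff_rescale, PowerSeries.coeff_mk, quasiSeries,
    Nat.dvd_iff_mod_eq_zero]
  split_ifs <;> simp

/-- Since Q = -c(1-y) for y = z^M/c, the normalising constant of `P` turns (1-y)^(4k+2) into
Q^(4k+2). The remaining series in y lives on the residue 0 only. -/
theorem coe_P (k : ℕ) (hk : 1 ≤ k) (s : ℚ[X]) (hs : s.natDegree ≤ 4 * k) :
    (P k s : PowerSeries ℚ)
      = (PowerSeries.X ^ (4 * k) - PowerSeries.C ((-4) ^ k)) ^ (4 * k + 2)
        * quasiSeries (4 * k) ((-4) ^ k)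
          (fun r => if r = 0 then fun x => (8 * (k : ℚ) * x + 1) * s.eval x else 0) := by
  have h0 : ((-4 : ℚ) ^ k) ≠ 0 := by positivity
  have hM : 4 * k ≠ 0 := by omega
  rw [P, coe_mul, ← substPow_coe _ hM, coe_T k s hs, map_mul, genFun,
    substPow_mk _ hM _ (fun x : ℚ => (8 * (k : ℚ) * x + 1) * s.eval x), ← mul_assoc]
  congr 1
  have h1 : substPow (4 * k) hM ((-4) ^ k) (1 - PowerSeries.X)
      = 1 - PowerSeries.C (((-4) ^ k)⁻¹) * PowerSeries.X ^ (4 * k) := by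
    simp [substPow, PowerSeries.rescale_X, PowerSeries.expand_C, PowerSeries.expand_X]
  rw [map_pow, map_pow, h1, coe_pow, coe_C, ← mul_pow]
  congr 1
  have h2 : (PowerSeries.C ((-4 : ℚ) ^ k)) * PowerSeries.C (((-4) ^ k)⁻¹) = 1 := by
    rw [← map_mul, mul_inv_cancel₀ h0, map_one]
  rw [map_neg]
  linear_combination PowerSeries.X ^ (4 * k) * h2

/-- The differential operator `f ↦ (4z-1) f' + 2f` on power series. -/
noncomputable def diffOp (f : PowerSeries ℚ) : PowerSeries ℚ :=
  (4 * PowerSeries.X - 1) * PowerSeries.derivative ℚ f + 2 * f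

theorem coeff_diffOp (f : PowerSeries ℚ) (m : ℕ) :
    PowerSeries.coeff m (diffOp f)
      = (4 * m + 2) * PowerSeries.coeff m f - (m + 1) * PowerSeries.coeff (m + 1) f := by
  have e : diffOp f = PowerSeries.C (4 : ℚ) * (PowerSeries.X * PowerSeries.derivative ℚ f)
      - PowerSeries.derivative ℚ f + PowerSeries.C (2 : ℚ) * f := by
    have h4 : PowerSeries.C (4 : ℚ) = 4 := rfl
    have h2 : PowerSeries.C (2 : ℚ) = 2 := rfl
    rw [diffOp, h4, h2]
    ring
  rw [e, map_add, map_sub, PowerSeries.coeff_C_mul, PowerSeries.coeff_C_mul,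
    PowerSeries.coeff_derivative]
  rcases m with _ | m
  · simp
    ring
  · rw [PowerSeries.coeff_succ_X_mul, PowerSeries.coeff_derivative]
    push_cast
    ring

theorem linPart_eq (k : ℕ) (a : ℕ → ℚ) :
    linPart k a = -(1 - 4 * X) * Q k * derivative (Rcheck k a)
      + (2 * Q k + C (4 * (k : ℚ) * (4 * k + 1)) * (1 - 4 * X) * X ^ (4 * k - 1)) * Rcheck k a
      - P k (S k a) := by
  have hR0 : Rcheck k 0 = 0 := by simp [Rcheck]
  have hS0 : S k 0 = 0 := by simp [S]
  have hT0 : T k 0 = 0 := by simpa using T_C_mul k 0 0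
  change diffEq k a - diffEq k 0 = _
  simp only [diffEq, hR0, hS0, P, hT0, zero_comp, derivative_zero]
  ring

/-- For `Ř = Q^(4k+1) f`, the linear part of the equation is `Q^(4k+2)` times a first order
operator applied to `f` minus the series of `(8kn+1) S(n)`. -/
theorem coe_linPart (k : ℕ) (hk : 1 ≤ k) (a : ℕ → ℚ) (f : PowerSeries ℚ)
    (hf : (Rcheck k a : PowerSeries ℚ)
      = (PowerSeries.X ^ (4 * k) - PowerSeries.C ((-4) ^ k)) ^ (4 * k + 1) * f) :
    (linPart k a : PowerSeries ℚ)
      = (PowerSeries.X ^ (4 * k) - PowerSeries.C ((-4) ^ k)) ^ (4 * k + 2)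
        * (diffOp f - quasiSeries (4 * k) ((-4) ^ k)
          (fun r => if r = 0 then fun x => (8 * (k : ℚ) * x + 1) * (S k a).eval x else 0)) := by
  have hd : PowerSeries.derivative ℚ (Rcheck k a : PowerSeries ℚ)
      = ((4 * k + 1 : ℕ) : PowerSeries ℚ) * (PowerSeries.X ^ (4 * k) - PowerSeries.C ((-4) ^ k)) ^ (4 * k)
          * (((4 * k : ℕ) : PowerSeries ℚ) * PowerSeries.X ^ (4 * k - 1)) * f
        + (PowerSeries.X ^ (4 * k) - PowerSeries.C ((-4) ^ k)) ^ (4 * k + 1)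
          * PowerSeries.derivative ℚ f := by
    rw [hf, Derivation.leibniz, Derivation.leibniz_pow, map_sub, Derivation.leibniz_pow,
      PowerSeries.derivative_X, PowerSeries.derivative_C]
    simp only [smul_eq_mul, nsmul_eq_mul, Nat.add_sub_cancel]
    ring
  have hC : PowerSeries.C (4 * (k : ℚ) * (4 * k + 1)) = 4 * (k : PowerSeries ℚ) * (4 * k + 1) := by
    have h4 : PowerSeries.C (4 : ℚ) = 4 := rfl
    simp [h4]
  have hl : (linPart k a : PowerSeries ℚ)
      = -(1 - 4 * PowerSeries.X) * (Q k : PowerSeries ℚ)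
          * PowerSeries.derivative ℚ (Rcheck k a : PowerSeries ℚ)
        + (2 * (Q k : PowerSeries ℚ) + PowerSeries.C (4 * (k : ℚ) * (4 * k + 1))
          * (1 - 4 * PowerSeries.X) * PowerSeries.X ^ (4 * k - 1)) * (Rcheck k a : PowerSeries ℚ)
        - (P k (S k a) : PowerSeries ℚ) := by
    have h4 : ((4 : ℚ[X]) : PowerSeries ℚ) = 4 := Polynomial.coe_C (4 : ℚ)
    have h2 : ((2 : ℚ[X]) : PowerSeries ℚ) = 2 := Polynomial.coe_C (2 : ℚ)
    rw [linPart_eq, PowerSeries.derivative_coe]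
    push_cast
    rw [h4, h2]
  rw [hl, hd, coe_P k hk _ (natDegree_S_le k a), hf, coe_Q, hC, diffOp]
  push_cast
  ring

/-! ### Triangularity up to a row permutation, and the sign of the matching. -/

/-- A matrix that is triangular up to the permutation `π` of its rows, the order being given by
a weight of the rows. -/
theorem det_eq_sign_mul_prod {ι R : Type*} [Fintype ι] [DecidableEq ι] [CommRing R]
    (A : Matrix ι ι R) (π : Equiv.Perm ι) (w : ι → ℕ)
    (h : ∀ i j, A i j ≠ 0 → i = π j ∨ w i < w (π j)) :
    A.det = (Equiv.Perm.sign π : ℤ) * ∏ j, A (π j) j := by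
  rw [Matrix.det_apply, Finset.sum_eq_single π]
  · rw [Units.smul_def, zsmul_eq_mul]
  · intro σ _ hσ
    by_contra hne
    have hprod : ∏ i, A (σ i) i ≠ 0 := fun h0 => hne (by rw [h0, smul_zero])
    have hA : ∀ j, σ j = π j ∨ w (σ j) < w (π j) := fun j =>
      h _ _ fun h0 => hprod (Finset.prod_eq_zero (Finset.mem_univ j) h0)
    obtain ⟨j, hj⟩ : ∃ j, σ j ≠ π j := by
      by_contra hall
      push Not at hall
      exact hσ (Equiv.ext hall)
    -- Both sums run over the weights of all rows, so they cannot differ: no σ other than π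
    -- contributes to the Leibniz formula.
    have hlt : ∑ i, w (σ i) < ∑ i, w (π i) :=
      Finset.sum_lt_sum (fun i _ => (hA i).elim (fun e => by rw [e]) le_of_lt)
        ⟨j, Finset.mem_univ j, (hA j).resolve_left hj⟩
    rw [Equiv.sum_comp σ w, Equiv.sum_comp π w] at hlt
    exact lt_irrefl _ hlt
  · simp

theorem det_eq_prod_of_weight {ι R : Type*} [Fintype ι] [DecidableEq ι] [CommRing R]
    (A : Matrix ι ι R) (w : ι → ℕ) (h : ∀ i j, A i j ≠ 0 → i = j ∨ w i < w j) :
    A.det = ∏ j, A j j := by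
  simpa using det_eq_sign_mul_prod A 1 w h

/-- The unknown with index `M d + r + 1` is a coefficient of `S`. -/
def IsS (M d r : ℕ) : Prop := M + 1 ≤ d ∨ (d = M ∧ r + 1 = M)

instance (M d r : ℕ) : Decidable (IsS M d r) := by unfold IsS; infer_instance

/-- The exponent of `n` to which the coefficient of `S` in position `(d, r)` belongs. -/
def idxS (M d r : ℕ) : ℕ := if d = M then 0 else r + 1

/-- The row matched with a column. -/
def matchRow (M : ℕ) (p : ℕ × ℕ) : ℕ × ℕ :=
  if IsS M p.1 p.2 then (idxS M p.1 p.2 + 1, 0)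
  else if p.1 ≤ p.2 then p else (p.1 + 1, p.2 + 1)

theorem matchRow_mem {M : ℕ} {p : ℕ × ℕ} (h1 : p.1 < M + 2) (h2 : p.2 < M) :
    (matchRow M p).1 < M + 2 ∧ (matchRow M p).2 < M := by
  obtain ⟨d, r⟩ := p
  simp only [matchRow, IsS, idxS] at *
  split_ifs <;> simp <;> omega

theorem matchRow_inj {M : ℕ} {p q : ℕ × ℕ} (h1 : p.1 < M + 2) (h2 : p.2 < M)
    (h3 : q.1 < M + 2) (h4 : q.2 < M) (h : matchRow M p = matchRow M q) : p = q := by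
  obtain ⟨d, r⟩ := p
  obtain ⟨e, s⟩ := q
  simp only [matchRow, IsS, idxS] at *
  split_ifs at h <;> simp only [Prod.mk.injEq] at h ⊢ <;> omega

/-- The matching of columns with rows as a permutation. -/
noncomputable def matching (M : ℕ) : Equiv.Perm (Fin (M + 2) × Fin M) :=
  Equiv.ofBijective
    (fun u => (⟨(matchRow M (u.1, u.2)).1, (matchRow_mem u.1.2 u.2.2).1⟩,
      ⟨(matchRow M (u.1, u.2)).2, (matchRow_mem u.1.2 u.2.2).2⟩))
    (Finite.injective_iff_bijective.mp fun u v h => by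
      simp only [Prod.mk.injEq, Fin.mk.injEq] at h
      have := matchRow_inj u.1.2 u.2.2 v.1.2 v.2.2 (Prod.ext h.1 h.2)
      simp only [Prod.mk.injEq] at this
      exact Prod.ext (Fin.ext this.1) (Fin.ext this.2))

theorem matching_iterate (M : ℕ) (j : ℕ) (u : Fin (M + 2) × Fin M) :
    (((((matching M) ^ j) u).1 : ℕ), ((((matching M) ^ j) u).2 : ℕ))
      = (matchRow M)^[j] (u.1, u.2) := by
  induction j with
  | zero => simp
  | succ j ih =>
    rw [Function.iterate_succ_apply', ← ih, pow_succ']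
    rfl

theorem matchRow_iterate_diag (M d r j : ℕ) (hd : r < d) (hj : d + j ≤ M + 1)
    (hr : r + j < M) : (matchRow M)^[j] (d, r) = (d + j, r + j) := by
  induction j with
  | zero => simp
  | succ j ih =>
    rw [Function.iterate_succ_apply', ih (by omega) (by omega), matchRow, if_neg, if_neg]
    · rfl
    · simp; omega
    · simp only [IsS]; omega

theorem matchRow_iterate_fix (M d r j : ℕ) (hd : d ≤ r) (hr : r < M) :
    (matchRow M)^[j] (d, r) = (d, r) := by
  induction j with
  | zero => rfl
  | succ j ih =>
    rw [Function.iterate_succ_apply', ih, matchRow, if_neg, if_pos hd]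
    simp only [IsS]; omega

/-- The matching moves down the diagonal d - r = e+2 and then jumps to the top of the diagonal d - r
= M+1-e, and conversely. These diagonals have M-e and e+1 positions, so M+1 steps lead back. -/
theorem matchRow_iterate_far (M d r : ℕ) (hd : r + 2 ≤ d) (hdM : d ≤ M + 1) :
    (matchRow M)^[M + 1] (d, r) = (d, r) := by
  obtain ⟨e, rfl⟩ : ∃ e, d = r + 2 + e := ⟨d - r - 2, by omega⟩
  obtain ⟨q, rfl⟩ : ∃ q, M = r + 1 + e + q := ⟨M - (r + 1 + e), by omega⟩
  set M := r + 1 + e + q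
  have h1 : (matchRow M)^[q] (r + 2 + e, r) = (r + 2 + e + q, r + q) :=
    matchRow_iterate_diag _ _ _ _ (by omega) (by omega) (by omega)
  have h2 : matchRow M (r + 2 + e + q, r + q) = (r + q + 2, 0) := by
    rw [matchRow, if_pos, idxS, if_neg] <;> simp [IsS, M]
  have h3 : (matchRow M)^[e] (r + q + 2, 0) = (r + q + 2 + e, 0 + e) :=
    matchRow_iterate_diag _ _ _ _ (by omega) (by omega) (by omega)
  have h4 : matchRow M (r + q + 2 + e, 0 + e) = (e + 2, 0) := by
    rw [matchRow, if_pos, idxS, if_neg] <;> simp [IsS, M] <;> omega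
  have h5 : (matchRow M)^[r] (e + 2, 0) = (e + 2 + r, 0 + r) :=
    matchRow_iterate_diag _ _ _ _ (by omega) (by omega) (by omega)
  have hM : M + 1 = r + (1 + (e + (1 + q))) := by omega
  rw [hM, Function.iterate_add_apply, Function.iterate_add_apply _ 1,
    Function.iterate_add_apply _ e, Function.iterate_add_apply _ 1 q, h1, Function.iterate_one, h2,
    h3, h4, h5]
  ext <;> simp; omega

/-- The diagonal d = r+1 is a cycle of length M, closed by the jump from (M, M-1) to (1, 0). Hence
M+1 steps amount to a single one. -/
theorem matchRow_iterate_near (M r : ℕ) (hM : 2 ≤ M) (hr : r < M) :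
    (matchRow M)^[M + 1] (r + 1, r) = if r + 1 = M then (1, 0) else (r + 2, r + 1) := by
  obtain ⟨q, rfl⟩ : ∃ q, M = r + 1 + q := ⟨M - (r + 1), by omega⟩
  set M := r + 1 + q
  have h1 : (matchRow M)^[q] (r + 1, r) = (r + 1 + q, r + q) :=
    matchRow_iterate_diag _ _ _ _ (by omega) (by omega) (by omega)
  have h2 : matchRow M (r + 1 + q, r + q) = (1, 0) := by
    have hd : r + 1 + q = M := rfl
    have hr' : r + q + 1 = M := by omega
    rw [matchRow, if_pos (show IsS M _ _ from Or.inr ⟨hd, hr'⟩), idxS, if_pos hd]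
  have h3 : (matchRow M)^[r] (1, 0) = (1 + r, 0 + r) :=
    matchRow_iterate_diag _ _ _ _ (by omega) (by omega) (by omega)
  have hM' : M + 1 = 1 + (r + (1 + q)) := by omega
  rw [hM', Function.iterate_add_apply, Function.iterate_add_apply _ r,
    Function.iterate_add_apply _ 1 q, h1, Function.iterate_one, h2, h3, matchRow]
  by_cases hq : q = 0
  · rw [if_pos, if_pos] <;> simp [IsS, idxS, M] <;> omega
  · rw [if_neg, if_neg, if_neg] <;> simp [IsS, M] <;> omega

/-- The embedding of the diagonal `d = r + 1`. -/
def diagEmb (M : ℕ) : Fin M ↪ Fin (M + 2) × Fin M where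
  toFun r := (⟨r + 1, by omega⟩, r)
  inj' r s h := by simpa using congrArg Prod.snd h

theorem diagEmb_apply (M : ℕ) (r : Fin M) :
    diagEmb M r = (⟨r + 1, by omega⟩, r) := rfl

theorem matching_pow (M : ℕ) (hM : 2 ≤ M) :
    matching M ^ (M + 1) = (finRotate M).viaFintypeEmbedding (diagEmb M) := by
  ext1 u
  have h := matching_iterate M (M + 1) u
  suffices hs : ((matching M ^ (M + 1)) u).1.val
        = (((finRotate M).viaFintypeEmbedding (diagEmb M)) u).1.val
      ∧ ((matching M ^ (M + 1)) u).2.val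
        = (((finRotate M).viaFintypeEmbedding (diagEmb M)) u).2.val from
    Prod.ext (Fin.ext hs.1) (Fin.ext hs.2)
  rw [← Prod.mk.injEq, h]
  obtain ⟨⟨d, hd⟩, ⟨r, hr⟩⟩ := u
  by_cases hdr : d = r + 1
  · subst hdr
    have e : ((⟨r + 1, hd⟩, ⟨r, hr⟩) : Fin (M + 2) × Fin M) = diagEmb M ⟨r, hr⟩ := rfl
    rw [e, Equiv.Perm.viaFintypeEmbedding_apply_image]
    obtain ⟨m, rfl⟩ : ∃ m, M = m + 1 := ⟨M - 1, by omega⟩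
    rw [diagEmb_apply, diagEmb_apply, matchRow_iterate_near _ _ hM hr]
    simp only [coe_finRotate, Fin.ext_iff, Fin.val_last]
    split_ifs <;> simp <;> omega
  · rw [Equiv.Perm.viaFintypeEmbedding_apply_notMem_range]
    · by_cases hle : d ≤ r
      · exact matchRow_iterate_fix _ _ _ _ hle hr
      · exact matchRow_iterate_far _ _ _ (by simp; omega) (by simp; omega)
    · rintro ⟨s, hs⟩
      simp only [diagEmb_apply, Prod.mk.injEq, Fin.ext_iff] at hs
      omega

/-- The power with exponent M+1 is a single cycle of even length M, hence odd. As M+1 is odd, the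
permutation has the same sign as that power, and its full cycle type is not needed. -/
theorem sign_matching (M : ℕ) (hM : 2 ≤ M) (he : Even M) :
    Equiv.Perm.sign (matching M) = -1 := by
  have h : Equiv.Perm.sign (matching M) ^ (M + 1) = -1 := by
    rw [← map_pow, matching_pow M hM, Equiv.Perm.viaFintypeEmbedding_sign, sign_finRotate]
    exact Odd.neg_one_pow (Nat.Even.sub_odd (by omega) he odd_one)
  rcases Int.units_eq_one_or (Equiv.Perm.sign (matching M)) with h1 | h1
  · rw [h1, one_pow] at h
    exact absurd h (by decide)
  · exact h1

/-! ### The Newton basis and the images of the new columns. -/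

/-- The Newton basis for the nodes `-(2s+1)/(2M)`. -/
noncomputable def newton (M d : ℕ) : ℚ[X] :=
  ∏ s ∈ Finset.range d, (X + C ((2 * (s : ℚ) + 1) / (2 * M)))

theorem newton_monic (M d : ℕ) : (newton M d).Monic :=
  monic_prod_of_monic _ _ fun _ _ => monic_X_add_C _

theorem natDegree_newton (M d : ℕ) : (newton M d).natDegree = d := by
  rw [newton, natDegree_prod_of_monic _ _ fun _ _ => monic_X_add_C _]
  simp

theorem eval_newton_succ (M d : ℕ) (x : ℚ) :
    (newton M (d + 1)).eval x = (newton M d).eval x * (x + (2 * d + 1) / (2 * M)) := by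
  rw [newton, Finset.prod_range_succ, ← newton, eval_mul, eval_add, eval_X, eval_C]

/-- The component with residue `j` of the `Ř`-part of the new column `(d, r)`. -/
noncomputable def colF (M d r j : ℕ) : ℚ[X] :=
  if IsS M d r then 0
  else if r + 1 = M then (if j = 0 then X * (newton M d).comp (X - 1) else 0)
  else if j = r + 1 then newton M d else 0

/-- The `S`-part of the new column `(d, r)`. -/
noncomputable def colS (M d r : ℕ) : ℚ[X] :=
  if IsS M d r then newton M (idxS M d r)
  else if r + 1 = M then 2 * (X * (newton M d).comp (X - 1)) else 0

/-- The series of the `Ř`-part of the new column `(d, r)`. -/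
noncomputable def colSeries (M : ℕ) (c : ℚ) (d r : ℕ) : PowerSeries ℚ :=
  quasiSeries M c fun j x => (colF M d r j).eval x

/-- The image of the new column `(d, r)` under the linear part of the equation, divided by
`Q^(4k+2)`. -/
noncomputable def imSeries (M : ℕ) (c : ℚ) (d r : ℕ) : PowerSeries ℚ :=
  diffOp (colSeries M c d r)
    - quasiSeries M c
      (fun j => if j = 0 then fun x => (2 * (M : ℚ) * x + 1) * (colS M d r).eval x else 0)

/-- The coefficient of the Newton polynomial of degree `e` in the residue `j` component of the
image of the new column `(d, r)`. -/
noncomputable def coreEntry (M : ℕ) (c : ℚ) (e j d r : ℕ) : ℚ :=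
  if IsS M d r then
    if j = 0 then
      if e = idxS M d r + 1 then -(2 * M) else if e = idxS M d r then 2 * idxS M d r else 0
    else 0
  else if r + 1 = M then
    if j = r then
      if e = d + 2 then -(c⁻¹ * M)
      else if e = d + 1 then
        -(c⁻¹ * M) * ((1 - (2 * (d + 1) + 1) / (2 * M)) + (1 - (2 * d + 1) / (2 * M)))
      else if e = d then -(c⁻¹ * M) * (1 - (2 * d + 1) / (2 * M)) ^ 2 else 0
    else 0
  else if j = r then
    if e = d + 1 then -M else if e = d then -(2 * ((r : ℚ) - d) + 1) / 2 else 0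
  else if j = r + 1 then
    if e = d + 1 then 4 * M else if e = d then -4 * ((d : ℚ) - (r + 1)) else 0
  else 0

theorem sum_two (n d : ℕ) (hd : d + 1 < n) (x y : ℚ) (f : ℕ → ℚ) :
    ∑ e ∈ Finset.range n, (if e = d + 1 then x else if e = d then y else 0) * f e
      = x * f (d + 1) + y * f d := by
  have h : ∀ e, (if e = d + 1 then x else if e = d then y else 0) * f e
      = (if e = d + 1 then x * f (d + 1) else 0) + (if e = d then y * f d else 0) := by
    intro e
    by_cases h1 : e = d + 1
    · subst h1; simp
    · by_cases h2 : e = d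
      · subst h2; simp
      · simp [h1, h2]
  simp only [h, Finset.sum_add_distrib, Finset.sum_ite_eq', Finset.mem_range]
  rw [if_pos hd, if_pos (by omega)]

theorem sum_three (n d : ℕ) (hd : d + 2 < n) (w x y : ℚ) (f : ℕ → ℚ) :
    ∑ e ∈ Finset.range n, (if e = d + 2 then w else if e = d + 1 then x else
      if e = d then y else 0) * f e = w * f (d + 2) + x * f (d + 1) + y * f d := by
  have h : ∀ e, (if e = d + 2 then w else if e = d + 1 then x else if e = d then y else 0) * f e
      = (if e = d + 2 then w * f (d + 2) else 0)
        + (if e = d + 1 then x else if e = d then y else 0) * f e := by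
    intro e
    by_cases h1 : e = d + 2
    · subst h1; simp
    · simp [h1]
  simp only [h, Finset.sum_add_distrib, sum_two n d (by omega), Finset.sum_ite_eq',
    Finset.mem_range]
  rw [if_pos hd, add_assoc]

/-- A component in residue r+1 < M contributes (4m+2) times itself to residue r+1 and -(m+1) times
itself to residue r; each linear factor in t is rewritten with the next Newton factor. For r+1 = M
the component F_0 comes with S = 2F_0, so that (4Mt+2)F_0 - (2Mt+1)S vanishes in residue 0. Only
residue M-1 survives, where F_0(t+1) = (t+1) · newton_d(t) is multiplied by -c⁻¹M(t+1); the shift by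
1 in `colF` is made for this. -/
theorem coeff_imSeries {M : ℕ} (hM : 2 ≤ M) (c : ℚ) (t j : ℕ) (hj : j < M) (d r : ℕ)
    (hr : r < M) :
    PowerSeries.coeff (M * t + j) (imSeries M c d r)
      = c⁻¹ ^ t * ∑ e ∈ Finset.range (M + 2), coreEntry M c e j d r * (newton M e).eval (t : ℚ) := by
  have hM0 : (M : ℚ) ≠ 0 := by positivity
  have hnext : PowerSeries.coeff (M * t + j + 1) (colSeries M c d r)
      = if j + 1 = M then c⁻¹ ^ (t + 1) * (colF M d r 0).eval ((t : ℚ) + 1)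
        else c⁻¹ ^ t * (colF M d r (j + 1)).eval (t : ℚ) := by
    split_ifs with h
    · have e : M * t + j + 1 = M * (t + 1) + 0 := by rw [mul_add]; omega
      rw [e, colSeries, coeff_quasiSeries _ _ _ _ _ (by omega)]
      push_cast
      rfl
    · rw [add_assoc, colSeries, coeff_quasiSeries _ _ _ _ _ (by omega)]
  rw [imSeries, map_sub, coeff_diffOp, hnext, coeff_quasiSeries _ _ _ _ _ hj, colSeries,
    coeff_quasiSeries _ _ _ _ _ hj]
  clear hnext
  simp only [coreEntry, colF, colS]
  generalize c⁻¹ = b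
  by_cases hS : IsS M d r
  · simp only [if_pos hS]
    by_cases hj0 : j = 0
    · simp only [if_pos hj0]
      rw [sum_two _ _ (by simp only [IsS, idxS] at *; split_ifs <;> omega), eval_newton_succ]
      simp
      field_simp
      ring
    · simp [hj0]
  simp only [if_neg hS]
  by_cases hG : r + 1 = M
  · simp only [if_pos hG]
    by_cases hjr : j = r
    · have hj0 : j ≠ 0 := by omega
      have hjM : j + 1 = M := by omega
      have hcast : (j : ℚ) = M - 1 := by rw [← hjM]; push_cast; ring
      simp only [if_pos hjr, if_neg hj0, if_pos hjM]
      rw [sum_three _ _ (by simp only [IsS] at hS; omega), eval_newton_succ, eval_newton_succ]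
      simp
      rw [hcast, pow_succ]
      field_simp
      ring
    · have hjM : j + 1 ≠ M := by omega
      simp only [if_neg hjr, if_neg hjM]
      by_cases hj0 : j = 0
      · simp [hj0]
        ring
      · simp [hj0]
  simp only [if_neg hG]
  have hz : (if j = 0 then (fun _ => 0) else 0 : ℚ → ℚ) t = 0 := by split_ifs <;> rfl
  by_cases hjr : j = r
  · have h1 : j + 1 ≠ M := by omega
    subst hjr
    simp only [if_neg h1, if_true]
    rw [sum_two _ _ (by simp only [IsS] at hS; omega), eval_newton_succ]
    simp [hz]
    field_simp
    ring
  by_cases hj1 : j = r + 1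
  · subst hj1
    simp only [if_neg hjr, if_true]
    rw [sum_two _ _ (by simp only [IsS] at hS; omega), eval_newton_succ]
    simp
    field_simp
    ring
  · simp [hjr, hj1, hz]

theorem natDegree_shifted_newton_le (M d : ℕ) :
    (X * (newton M d).comp (X - 1)).natDegree ≤ d + 1 := by
  refine natDegree_mul_le.trans ?_
  have h : (X - 1 : ℚ[X]).natDegree = 1 := by compute_degree!
  rw [natDegree_comp, natDegree_newton, h, natDegree_X, mul_one, add_comm]

theorem natDegree_colF_lt (M d r j : ℕ) : (colF M d r j).natDegree < M + 1 := by
  rw [colF]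
  split_ifs with h1 h2 h3 h3
  · simp
  · have := natDegree_shifted_newton_le M d
    simp only [IsS] at h1
    omega
  · simp
  · rw [natDegree_newton]
    simp only [IsS] at h1
    omega
  · simp

theorem natDegree_colS_le (M d r : ℕ) (hr : r < M) : (colS M d r).natDegree ≤ M := by
  rw [colS]
  split_ifs with h1 h2
  · rw [natDegree_newton, idxS]
    split_ifs <;> omega
  · have := natDegree_shifted_newton_le M d
    have h3 := natDegree_mul_le (p := 2) (q := X * (newton M d).comp (X - 1))
    rw [natDegree_ofNat] at h3
    simp only [IsS] at h1
    omega
  · simp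

/-- The factor X in the residue 0 component serves this purpose: `Rcheck` has no constant term. -/
theorem coeff_zero_colSeries {M : ℕ} (hM : 0 < M) (c : ℚ) (d r : ℕ) :
    PowerSeries.coeff 0 (colSeries M c d r) = 0 := by
  have := coeff_quasiSeries M c (fun j x => (colF M d r j).eval x) 0 0 hM
  simp only [mul_zero, add_zero] at this
  rw [colSeries, this, colF]
  split_ifs <;> first | contradiction | simp

/-- The unknowns of the new column `(d, r)`. -/
noncomputable def colUnknown (k d r : ℕ) : ℕ → ℚ := fun j =>
  if j < N k then PowerSeries.coeff j
    ((PowerSeries.X ^ (4 * k) - PowerSeries.C ((-4) ^ k)) ^ (4 * k + 1)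
      * colSeries (4 * k) ((-4) ^ k) d r)
  else (colS (4 * k) d r).coeff (j - N k)

theorem coe_Rcheck_colUnknown (k : ℕ) (hk : 1 ≤ k) (d r : ℕ) :
    (Rcheck k (colUnknown k d r) : PowerSeries ℚ)
      = (PowerSeries.X ^ (4 * k) - PowerSeries.C ((-4) ^ k)) ^ (4 * k + 1)
        * colSeries (4 * k) ((-4) ^ k) d r := by
  have hM : 0 < 4 * k := by omega
  have hc : ((-4 : ℚ) ^ k) ≠ 0 := by positivity
  ext j
  have h : (Rcheck k (colUnknown k d r)).coeff j
      = if j ∈ Finset.Ico 1 (N k) then colUnknown k d r j else 0 := by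
    simp only [Rcheck, finsetSum_coeff, coeff_C_mul, coeff_X_pow, mul_ite, mul_one, mul_zero,
      Finset.sum_ite_eq]
  simp only [coeff_coe, h, Finset.mem_Ico]
  by_cases hj : j < N k
  · rcases Nat.eq_zero_or_pos j with rfl | hj0
    · rw [if_neg (by omega)]
      simp [PowerSeries.coeff_mul, coeff_zero_colSeries hM]
    · rw [if_pos ⟨hj0, hj⟩, colUnknown, if_pos hj]
  -- The components have degree at most M, so the difference of order M+1 annihilates them and no
  -- coefficient from z^(M(M+1)) on survives.
  · rw [if_neg (by omega), colSeries, coeff_pow_mul_quasiSeries_eq_zero hM hc]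
    · exact fun i => fwdDiff_iter_eq_zero_of_degree_lt (natDegree_colF_lt _ _ _ _)
    · rw [N] at hj
      nlinarith

theorem S_colUnknown (k d r : ℕ) (hr : r < 4 * k) :
    S k (colUnknown k d r) = colS (4 * k) d r := by
  ext j
  have h : (S k (colUnknown k d r)).coeff j
      = if j ∈ Finset.range (4 * k + 1) then colUnknown k d r (N k + j) else 0 := by
    simp only [S, finsetSum_coeff, coeff_C_mul, coeff_X_pow, mul_ite, mul_one, mul_zero,
      Finset.sum_ite_eq]
  simp only [h, Finset.mem_range]
  split_ifs with hj
  · rw [colUnknown, if_neg (by omega), Nat.add_sub_cancel_left]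
  · rw [coeff_eq_zero_of_natDegree_lt]
    have := natDegree_colS_le (4 * k) d r hr
    omega

theorem coe_linPart_colUnknown (k : ℕ) (hk : 1 ≤ k) (d r : ℕ) (hr : r < 4 * k) :
    (linPart k (colUnknown k d r) : PowerSeries ℚ)
      = (PowerSeries.X ^ (4 * k) - PowerSeries.C ((-4) ^ k)) ^ (4 * k + 2)
        * imSeries (4 * k) ((-4) ^ k) d r := by
  rw [coe_linPart k hk _ _ (coe_Rcheck_colUnknown k hk d r), S_colUnknown k d r hr, imSeries]
  have : (8 * (k : ℚ)) = 2 * ((4 * k : ℕ) : ℚ) := by push_cast; ring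
  rw [this]

/-! ### Splitting off the multiplication by powers of Q. -/

/-- The matrix of the multiplication by a power series on the first `n` coefficients. -/
noncomputable def toeplitz (g : PowerSeries ℚ) (n : ℕ) : Matrix (Fin n) (Fin n) ℚ :=
  Matrix.of fun i j => if j ≤ i then PowerSeries.coeff ((i : ℕ) - j) g else 0

theorem sum_toeplitz (g h : PowerSeries ℚ) (n : ℕ) (i : Fin n) :
    ∑ j, toeplitz g n i j * PowerSeries.coeff (j : ℕ) h = PowerSeries.coeff (i : ℕ) (g * h) := by
  rw [mul_comm g h, PowerSeries.coeff_mul, Finset.Nat.sum_antidiagonal_eq_sum_range_succ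
    (fun a b => PowerSeries.coeff a h * PowerSeries.coeff b g)]
  simp only [toeplitz, Matrix.of_apply, Fin.le_def]
  rw [Fin.sum_univ_eq_sum_range (fun j => (if j ≤ (i : ℕ) then PowerSeries.coeff ((i : ℕ) - j) g
    else 0) * PowerSeries.coeff j h) n]
  symm
  refine Finset.sum_subset_zero_on_sdiff (by intro x; simp; omega) ?_ ?_
  · intro x hx
    simp only [Finset.mem_sdiff, Finset.mem_range] at hx
    rw [if_neg (by omega), zero_mul]
  · intro x hx
    rw [Finset.mem_range] at hx
    rw [if_pos (by omega), mul_comm]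

theorem det_toeplitz (g : PowerSeries ℚ) (n : ℕ) :
    (toeplitz g n).det = PowerSeries.constantCoeff g ^ n := by
  rw [det_eq_prod_of_weight _ (fun i : Fin n => n - i)]
  · simp [toeplitz]
  · intro i j h
    simp only [toeplitz, Matrix.of_apply, ne_eq, ite_eq_right_iff, Classical.not_imp, Fin.le_def] at h
    rw [Fin.ext_iff]
    omega

/-- The matrix of the multiplication by a power series on the coefficients of `z, …, z^m`, extended
by an identity matrix. -/
noncomputable def partialToeplitz (g : PowerSeries ℚ) (m n : ℕ) : Matrix (Fin n) (Fin n) ℚ :=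
  Matrix.of fun i j => if (i : ℕ) < m then toeplitz g n i j else if i = j then 1 else 0

theorem det_partialToeplitz (g : PowerSeries ℚ) (m n : ℕ) (hm : m ≤ n) :
    (partialToeplitz g m n).det = PowerSeries.constantCoeff g ^ m := by
  rw [det_eq_prod_of_weight _ (fun i : Fin n => n - i)]
  · simp only [partialToeplitz, toeplitz, Matrix.of_apply, le_refl, if_true, Nat.sub_self]
    rw [Fin.prod_univ_eq_prod_range (fun i => if i < m then PowerSeries.coeff 0 g else 1) n,
      Finset.prod_ite, Finset.prod_const_one, mul_one, Finset.prod_const]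
    have : Finset.filter (fun i => i < m) (Finset.range n) = Finset.range m := by
      ext x; simp; omega
    rw [this, Finset.card_range, PowerSeries.coeff_zero_eq_constantCoeff_apply]
  · intro i j h
    simp only [partialToeplitz, toeplitz, Matrix.of_apply, Fin.le_def] at h
    rw [Fin.ext_iff]
    split_ifs at h with h1 h2 h2
    · omega
    · exact absurd rfl h
    · left; rw [h2]
    · exact absurd rfl h

/-- The position `4 k d + r` of the index pair `(d, r)`. -/
def pos (k : ℕ) : Fin (4 * k + 2) × Fin (4 * k) ≃ Fin (N k + 4 * k) :=
  finProdFinEquiv.trans (finCongr (by rw [N]; ring))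

theorem pos_val (k : ℕ) (u : Fin (4 * k + 2) × Fin (4 * k)) :
    (pos k u : ℕ) = 4 * k * u.1 + u.2 := by
  simp [pos, add_comm]

/-- The new columns in terms of the unknowns. -/
noncomputable def colMatrix (k : ℕ) :
    Matrix (Fin (N k + 4 * k)) (Fin (4 * k + 2) × Fin (4 * k)) ℚ :=
  Matrix.of fun x u => colUnknown k u.1 u.2 (x + 1)

/-- The values of the components of the new columns. -/
noncomputable def valMatrix (k : ℕ) :
    Matrix (Fin (N k + 4 * k)) (Fin (4 * k + 2) × Fin (4 * k)) ℚ :=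
  Matrix.of fun x u => if (x : ℕ) < N k - 1
    then PowerSeries.coeff (x + 1) (colSeries (4 * k) ((-4) ^ k) u.1 u.2)
    else (colS (4 * k) u.1 u.2).coeff (x + 1 - N k)

/-- The coefficients of the images of the new columns. -/
noncomputable def imMatrix (k : ℕ) :
    Matrix (Fin (N k + 4 * k)) (Fin (4 * k + 2) × Fin (4 * k)) ℚ :=
  Matrix.of fun x u => PowerSeries.coeff x (imSeries (4 * k) ((-4) ^ k) u.1 u.2)

theorem colMatrix_eq (k : ℕ) (hk : 1 ≤ k) :
    colMatrix k = partialToeplitz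
      ((PowerSeries.X ^ (4 * k) - PowerSeries.C ((-4) ^ k)) ^ (4 * k + 1)) (N k - 1) (N k + 4 * k)
      * valMatrix k := by
  have hN : 1 ≤ N k := Nat.mul_pos (by omega) (by omega)
  ext x u
  set g : PowerSeries ℚ := (PowerSeries.X ^ (4 * k) - PowerSeries.C ((-4) ^ k)) ^ (4 * k + 1)
  rw [Matrix.mul_apply]
  simp only [colMatrix, valMatrix, partialToeplitz, Matrix.of_apply, colUnknown]
  by_cases hx : (x : ℕ) < N k - 1
  · simp only [if_pos hx]
    rw [if_pos (by omega)]
    -- Row x belongs to z^(x+1). Dividing by z, which is possible without a constant term, aligns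
    -- the indices with those of the Toeplitz matrix.
    have hf : colSeries (4 * k) ((-4) ^ k) u.1 u.2 = PowerSeries.X * PowerSeries.mk fun n =>
        PowerSeries.coeff (n + 1) (colSeries (4 * k) ((-4) ^ k) u.1 u.2) := by
      ext n
      rcases n with _ | n
      · rw [coeff_zero_colSeries (by omega), PowerSeries.coeff_zero_X_mul]
      · rw [PowerSeries.coeff_succ_X_mul, PowerSeries.coeff_mk]
    conv_lhs => rw [hf]
    rw [mul_left_comm, PowerSeries.coeff_succ_X_mul, ← sum_toeplitz]
    refine Finset.sum_congr rfl fun y _ => ?_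
    by_cases hy : y ≤ x
    · rw [if_pos (by rw [Fin.le_def] at hy; omega), PowerSeries.coeff_mk]
    · simp [toeplitz, hy]
  · simp only [if_neg hx]
    rw [if_neg (by omega)]
    rw [Finset.sum_eq_single x (fun y _ hy => by rw [if_neg hy.symm, zero_mul]) (by simp),
      if_pos rfl, one_mul, if_neg hx]

theorem A_mul_colMatrix (k : ℕ) (hk : 1 ≤ k) :
    A k * colMatrix k = toeplitz
      ((PowerSeries.X ^ (4 * k) - PowerSeries.C ((-4) ^ k)) ^ (4 * k + 2)) (N k + 4 * k)
      * imMatrix k := by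
  ext x u
  have h1 := coeff_diffEq k hk (colUnknown k u.1 u.2) x
  have h2 : (linPart k (colUnknown k u.1 u.2)).coeff (x : ℕ)
      = (diffEq k (colUnknown k u.1 u.2)).coeff x - (diffEq k 0).coeff x := coeff_sub _ _ _
  have h3 : (A k * colMatrix k) x u
      = (A k).mulVec (fun j => colUnknown k u.1 u.2 ((j : ℕ) + 1)) x := rfl
  rw [h3, Matrix.mul_apply]
  simp only [imMatrix, Matrix.of_apply]
  rw [sum_toeplitz, ← coe_linPart_colUnknown k hk _ _ u.2.2, coeff_coe, h2, h1]
  ring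

/-- The determinant of `A(k)` in terms of the values on both sides. -/
theorem det_A_mul (k : ℕ) (hk : 1 ≤ k) :
    (A k).det * ((-(-4) ^ k) ^ (4 * k + 1)) ^ (N k - 1) * ((valMatrix k).submatrix (pos k) id).det
      = ((-(-4) ^ k) ^ (4 * k + 2)) ^ (N k + 4 * k) * ((imMatrix k).submatrix (pos k) id).det := by
  have h : A k * (partialToeplitz
      ((PowerSeries.X ^ (4 * k) - PowerSeries.C ((-4) ^ k)) ^ (4 * k + 1)) (N k - 1) (N k + 4 * k)
      * valMatrix k) = toeplitz
      ((PowerSeries.X ^ (4 * k) - PowerSeries.C ((-4) ^ k)) ^ (4 * k + 2)) (N k + 4 * k)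
      * imMatrix k := by
    rw [← colMatrix_eq k hk, A_mul_colMatrix k hk]
  have h' := congrArg (fun B => (B.submatrix (pos k) id).det) h
  rw [← Matrix.mul_assoc, ← Matrix.submatrix_mul_equiv _ (valMatrix k) _ (pos k),
    ← Matrix.submatrix_mul_equiv _ (imMatrix k) _ (pos k), Matrix.det_mul, Matrix.det_mul,
    Matrix.det_submatrix_equiv_self, Matrix.det_submatrix_equiv_self, Matrix.det_mul,
    det_toeplitz, det_partialToeplitz _ _ _ (by omega)] at h'
  have h0 : PowerSeries.constantCoeff
      (PowerSeries.X ^ (4 * k) - PowerSeries.C ((-4 : ℚ) ^ k)) = -(-4) ^ k := by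
    have : 4 * k ≠ 0 := by omega
    simp [this]
  simp only [map_pow] at h' h0
  rwa [h0] at h'

/-! ### Factorization of the value matrix. -/

/-- The value at `t` in terms of the differences at `0`. -/
theorem eval_eq_sum_fwdDiff (p : ℚ[X]) (t n : ℕ) (ht : t < n) :
    p.eval (t : ℚ)
      = ∑ e ∈ Finset.range n, (t.choose e : ℚ) * (fwdDiff 1)^[e] (fun x => p.eval x) 0 := by
  have h := shift_eq_sum_fwdDiff_iter (1 : ℚ) (fun x => p.eval x) t 0
  simp only [nsmul_eq_mul, mul_one, zero_add] at h
  rw [h]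
  refine Finset.sum_subset (by intro x; simp; omega) fun e _ he => ?_
  rw [Finset.mem_range] at he
  rw [Nat.choose_eq_zero_of_lt (by omega)]
  simp

theorem fwdDiff_newton_self (M d : ℕ) :
    (fwdDiff 1)^[d] (fun x => (newton M d).eval x) (0 : ℚ) = d.factorial := by
  have h := congrFun (Polynomial.fwdDiff_iter_degree_eq_factorial (newton M d)) 0
  rw [natDegree_newton, (newton_monic M d).leadingCoeff] at h
  simpa using h

/-- The nonzero factor of the row `(t, r)` of the value matrix. -/
noncomputable def rowFactor (M : ℕ) (c : ℚ) (t r : ℕ) : ℚ :=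
  if r + 1 = M then c⁻¹ ^ (t + 1) * (t + 1) else c⁻¹ ^ t

/-- The lower triangular factor of the value matrix. -/
noncomputable def pascalMatrix (M : ℕ) (c : ℚ) :
    Matrix (Fin (M + 2) × Fin M) (Fin (M + 2) × Fin M) ℚ :=
  Matrix.of fun y e =>
    if IsS M y.1 y.2 then if y = e then 1 else 0
    else if y.2 = e.2 then rowFactor M c y.1 y.2 * ((y.1 : ℕ).choose e.1 : ℚ) else 0

/-- The upper triangular factor of the value matrix. -/
noncomputable def diffMatrix (M : ℕ) :
    Matrix (Fin (M + 2) × Fin M) (Fin (M + 2) × Fin M) ℚ :=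
  Matrix.of fun e u =>
    if IsS M e.1 e.2 then (colS M u.1 u.2).coeff (idxS M e.1 e.2)
    else if IsS M u.1 u.2 then 0
    else if e.2 = u.2 then (fwdDiff 1)^[(e.1 : ℕ)] (fun x => (newton M u.1).eval x) 0 else 0

theorem coeff_succ_colSeries {M : ℕ} (c : ℚ) (t j d r : ℕ) (hj : j < M)
    (hr : r < M) (hS : ¬ IsS M d r) :
    PowerSeries.coeff (M * t + j + 1) (colSeries M c d r)
      = if j = r then rowFactor M c t r * (newton M d).eval (t : ℚ) else 0 := by
  rw [rowFactor]
  by_cases h : j + 1 = M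
  · have e : M * t + j + 1 = M * (t + 1) + 0 := by rw [mul_add]; omega
    rw [e, colSeries, coeff_quasiSeries _ _ _ _ _ (by omega), colF, if_neg hS]
    by_cases hjr : j = r
    · subst hjr
      simp [h]
      ring
    · rw [if_neg (by omega), if_neg (by omega), if_neg hjr]
      simp
  · rw [add_assoc, colSeries, coeff_quasiSeries _ _ _ _ _ (by omega), colF, if_neg hS]
    by_cases hjr : j = r
    · subst hjr
      simp [h]
    · rw [if_neg hjr]
      by_cases hG : r + 1 = M
      · simp [hG]
      · rw [if_neg hG, if_neg (by omega)]
        simp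

/-- This is Newton's forward difference formula at 0, applied within each residue; rows belonging to
`S` are read off directly. -/
theorem valMatrix_eq (k : ℕ) :
    (valMatrix k).submatrix (pos k) id
      = pascalMatrix (4 * k) ((-4) ^ k) * diffMatrix (4 * k) := by
  ext y u
  have hN : N k = 4 * k * (4 * k) + 4 * k := by rw [N]; ring
  have hy2 := y.2.2
  rw [Matrix.mul_apply]
  simp only [Matrix.submatrix_apply, valMatrix, Matrix.of_apply, pos_val, id_eq, pascalMatrix]
  by_cases hS : IsS (4 * k) y.1 y.2
  · simp only [if_pos hS]
    have h1 : 4 * k * y.1 + y.2 + 1 - N k = idxS (4 * k) y.1 y.2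
        ∧ N k ≤ 4 * k * y.1 + y.2 + 1 := by
      rw [idxS]
      rcases hS with h | ⟨h, h'⟩
      · have : (y.1 : ℕ) = 4 * k + 1 := by omega
        rw [this, if_neg (by omega), mul_add]
        omega
      · rw [h, if_pos rfl]
        omega
    rw [if_neg (by omega), Finset.sum_eq_single y (fun e _ he => by rw [if_neg he.symm, zero_mul])
      (by simp), if_pos rfl, one_mul, h1.1, diffMatrix, Matrix.of_apply, if_pos hS]
  · simp only [if_neg hS]
    have hlt : 4 * k * y.1 + y.2 < N k - 1 := by
      simp only [IsS, not_or, not_le] at hS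
      by_cases hyM : (y.1 : ℕ) = 4 * k
      · rw [hyM]; omega
      · have : 4 * k * ((y.1 : ℕ) + 1) ≤ 4 * k * (4 * k) := Nat.mul_le_mul_left _ (by omega)
        rw [mul_add] at this
        omega
    rw [if_pos hlt]
    have hterm : ∀ e : Fin (4 * k + 2) × Fin (4 * k),
        (if y.2 = e.2 then rowFactor (4 * k) ((-4) ^ k) y.1 y.2 * ((y.1 : ℕ).choose e.1 : ℚ) else 0)
          * diffMatrix (4 * k) e u
        = if y.2 = e.2 then (if IsS (4 * k) u.1 u.2 then 0 else if y.2 = u.2 then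
          rowFactor (4 * k) ((-4) ^ k) y.1 y.2 * (((y.1 : ℕ).choose e.1 : ℚ) *
            (fwdDiff 1)^[(e.1 : ℕ)] (fun x => (newton (4 * k) u.1).eval x) 0) else 0) else 0 := by
      intro e
      by_cases he : y.2 = e.2
      · simp only [if_pos he]
        by_cases hle : (e.1 : ℕ) ≤ y.1
        -- Lowering d at fixed r never leads to a position of `S`, so the binomial expansion stays
        -- among the rows of the series.
        · have hSe : ¬ IsS (4 * k) e.1 e.2 := by
            rw [← he]
            simp only [IsS] at hS ⊢
            omega
          rw [diffMatrix, Matrix.of_apply, if_neg hSe, he]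
          split_ifs
          · rw [mul_zero]
          · rw [mul_assoc]
          · rw [mul_zero]
        · rw [Nat.choose_eq_zero_of_lt (by omega)]
          simp
      · simp only [if_neg he, zero_mul]
    rw [Finset.sum_congr rfl fun e _ => hterm e, Fintype.sum_prod_type]
    simp only [Finset.sum_ite_eq, Finset.mem_univ, if_true]
    by_cases hSu : IsS (4 * k) u.1 u.2
    · simp [hSu, colSeries, colF, quasiSeries]
    · rw [coeff_succ_colSeries _ _ _ _ _ hy2 u.2.2 hSu]
      simp only [if_neg hSu, Fin.ext_iff]
      by_cases hyu : (y.2 : ℕ) = u.2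
      · simp only [if_pos hyu]
        rw [← Finset.mul_sum, Fin.sum_univ_eq_sum_range (fun e => ((y.1 : ℕ).choose e : ℚ) *
            (fwdDiff 1)^[e] (fun x => (newton (4 * k) u.1).eval x) 0) (4 * k + 2),
          ← eval_eq_sum_fwdDiff _ _ _ y.1.2, hyu]
      · simp [hyu]

theorem det_pascalMatrix (M : ℕ) (c : ℚ) :
    (pascalMatrix M c).det
      = ∏ u : Fin (M + 2) × Fin M, if IsS M u.1 u.2 then 1 else rowFactor M c u.1 u.2 := by
  rw [det_eq_prod_of_weight _ (fun u : Fin (M + 2) × Fin M => M + 2 - u.1)]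
  · simp [pascalMatrix]
  · intro y e h
    simp only [pascalMatrix, Matrix.of_apply] at h
    split_ifs at h with h1 h2 h2
    · exact Or.inl h2
    · exact absurd rfl h
    · have hle : (e.1 : ℕ) ≤ y.1 := by
        by_contra hlt
        exact h (by rw [Nat.choose_eq_zero_of_lt (by omega)]; simp)
      rcases hle.eq_or_lt with h3 | h3
      · exact Or.inl (Prod.ext (Fin.ext h3.symm) h2)
      · right
        omega
    · exact absurd rfl h

theorem det_diffMatrix (M : ℕ) :
    (diffMatrix M).det
      = ∏ u : Fin (M + 2) × Fin M, if IsS M u.1 u.2 then 1 else ((u.1 : ℕ).factorial : ℚ) := by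
  -- The columns of `S` vanish outside the rows of `S`. These rows therefore get the smallest
  -- weights, at most M, and the others are placed above 2M.
  rw [det_eq_prod_of_weight _ (fun u : Fin (M + 2) × Fin M =>
    if IsS M u.1 u.2 then idxS M u.1 u.2 else 2 * M + u.1)]
  · refine Finset.prod_congr rfl fun u _ => ?_
    simp only [diffMatrix, Matrix.of_apply]
    split_ifs with h
    · rw [colS, if_pos h]
      have := (newton_monic M (idxS M u.1 u.2)).coeff_natDegree
      rwa [natDegree_newton] at this
    · exact fwdDiff_newton_self M u.1
  · intro e u h
    have he1 := e.1.2
    have he2 := e.2.2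
    have hu2 := u.2.2
    simp only [diffMatrix, Matrix.of_apply] at h
    by_cases h1 : IsS M e.1 e.2
    · simp only [if_pos h1] at h ⊢
      by_cases h2 : IsS M u.1 u.2
      · simp only [if_pos h2]
        rw [colS, if_pos h2] at h
        have hle : idxS M e.1 e.2 ≤ idxS M u.1 u.2 := by
          by_contra hlt
          exact h (coeff_eq_zero_of_natDegree_lt (by rw [natDegree_newton]; omega))
        rcases hle.eq_or_lt with h3 | h3
        · left
          have hu1 := u.1.2
          rw [Prod.ext_iff, Fin.ext_iff, Fin.ext_iff]
          simp only [IsS, idxS] at *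
          split_ifs at h3 <;> omega
        · exact Or.inr h3
      · simp only [if_neg h2]
        right
        simp only [IsS, idxS] at *
        split_ifs <;> omega
    · simp only [if_neg h1] at h ⊢
      split_ifs at h with h2 h3
      · exact absurd rfl h
      · rw [if_neg h2]
        have hle : (e.1 : ℕ) ≤ u.1 := by
          by_contra hlt
          refine h (congrFun (fwdDiff_iter_eq_zero_of_degree_lt ?_) 0)
          rw [natDegree_newton]
          omega
        rcases hle.eq_or_lt with h4 | h4
        · exact Or.inl (Prod.ext (Fin.ext h4) h3)
        · right
          omega
      · exact absurd rfl h

/-! ### Factorization of the image matrix. -/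

/-- The values of the Newton polynomials, one block for each residue. -/
noncomputable def newtonValues (M : ℕ) (c : ℚ) :
    Matrix (Fin (M + 2) × Fin M) (Fin (M + 2) × Fin M) ℚ :=
  Matrix.blockDiagonal fun _ : Fin M =>
    Matrix.of fun t e : Fin (M + 2) => c⁻¹ ^ (t : ℕ) * (newton M e).eval (t : ℚ)

theorem superFactorial_eq_prod (n : ℕ) :
    (n.superFactorial : ℚ) = ∏ t ∈ Finset.range (n + 1), (t.factorial : ℚ) := by
  induction n with
  | zero => simp
  | succ n ih =>
    rw [Finset.prod_range_succ, ← ih, Nat.superFactorial]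
    push_cast
    ring

theorem det_newtonValues (M : ℕ) (c : ℚ) :
    (newtonValues M c).det
      = (∏ t ∈ Finset.range (M + 2), c⁻¹ ^ t * (t.factorial : ℚ)) ^ M := by
  have h : (Matrix.of fun t e : Fin (M + 2) => (newton M e).eval (t : ℚ)).det
      = ∏ t ∈ Finset.range (M + 2), (t.factorial : ℚ) := by
    -- The Newton polynomials are monic of degrees 0, ..., M+1, so each block is a Vandermonde
    -- determinant at 0, ..., M+1 up to the powers of c⁻¹.
    rw [← Matrix.det_eval_matrixOfPolynomials_eq_det_vandermonde (fun i : Fin (M + 2) => (i : ℚ))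
      (fun e => newton M e) (fun e => natDegree_newton M e) (fun e => newton_monic M e),
      Matrix.det_vandermonde_id_eq_superFactorial, superFactorial_eq_prod]
  rw [newtonValues, Matrix.det_blockDiagonal]
  have h2 := Matrix.det_mul_column (fun t : Fin (M + 2) => c⁻¹ ^ (t : ℕ))
    (Matrix.of fun t e : Fin (M + 2) => (newton M e).eval (t : ℚ))
  simp only [Matrix.of_apply] at h2
  rw [h2, h, Finset.prod_const, Finset.card_univ, Fintype.card_fin, Finset.prod_mul_distrib,
    Fin.prod_univ_eq_prod_range (fun t => c⁻¹ ^ t)]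

/-- The matrix of the system with respect to the Newton polynomials. -/
noncomputable def coreMatrix (M : ℕ) (c : ℚ) :
    Matrix (Fin (M + 2) × Fin M) (Fin (M + 2) × Fin M) ℚ :=
  Matrix.of fun e u => coreEntry M c e.1 e.2 u.1 u.2

theorem imMatrix_eq (k : ℕ) (hk : 1 ≤ k) :
    (imMatrix k).submatrix (pos k) id
      = newtonValues (4 * k) ((-4) ^ k) * coreMatrix (4 * k) ((-4) ^ k) := by
  ext y u
  rw [Matrix.mul_apply]
  simp only [Matrix.submatrix_apply, imMatrix, Matrix.of_apply, pos_val, id_eq, newtonValues,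
    Matrix.blockDiagonal_apply, ite_mul, zero_mul, coreMatrix]
  rw [coeff_imSeries (by omega) _ _ _ y.2.2 _ _ u.2.2, Fintype.sum_prod_type]
  simp only [Finset.sum_ite_eq, Finset.mem_univ, if_true]
  rw [Finset.mul_sum, ← Fin.sum_univ_eq_sum_range (fun e => ((-4 : ℚ) ^ k)⁻¹ ^ (y.1 : ℕ) *
    (coreEntry (4 * k) ((-4) ^ k) e y.2 u.1 u.2 * (newton (4 * k) e).eval ((y.1 : ℕ) : ℚ)))]
  exact Finset.sum_congr rfl fun e _ => by ring

/-! ### Triangularity of the core matrix. -/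

/-- The weight with respect to which the core matrix is triangular. -/
def coreWeight (M : ℕ) (p : ℕ × ℕ) : ℕ :=
  if p.1 ≤ p.2 then 10 * M + 10 - (p.1 + p.2) else p.1 + p.2

/-- For columns not belonging to `S` the nonzero entries lie at or next to (d, r), in the direction
of larger indices. If d ≤ r, the position (d, r) has the largest weight, since the weight decreases
in d + r there and the region d > r lies far below. If d > r, the farthest corner (d+1, r+1) has the
largest weight, unless (d, r+1) falls into the region d ≤ r; this happens only for d = r+1, and then
that entry is 0. -/
theorem coreEntry_weight {M : ℕ} {c : ℚ} {e j d r : ℕ} (he : e < M + 2) (hj : j < M)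
    (hd : d < M + 2) (hr : r < M) (h : coreEntry M c e j d r ≠ 0) :
    (e, j) = matchRow M (d, r) ∨ coreWeight M (e, j) < coreWeight M (matchRow M (d, r)) := by
  by_cases hS : IsS M d r
  · simp only [coreEntry, if_pos hS] at h
    rw [matchRow, if_pos hS]
    dsimp only
    have hq : idxS M d r ≤ M := by rw [idxS]; split_ifs <;> omega
    generalize idxS M d r = q at h hq
    split_ifs at h with h1 h2 h3
    · left; rw [h1, h2]
    -- For q = 0 the row (0, 0) would have a large weight, but its entry 2q vanishes.
    · have : q ≠ 0 := by
        rintro rfl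
        simp at h
      right
      simp only [coreWeight]
      split_ifs <;> omega
    · exact absurd rfl h
    · exact absurd rfl h
  have hm : matchRow M (d, r) = if d ≤ r then (d, r) else (d + 1, r + 1) := by
    rw [matchRow, if_neg hS]
  simp only [coreEntry, if_neg hS] at h
  rw [hm]
  simp only [IsS, not_or, not_le] at hS
  -- Here the choice of the nodes is used: the coefficient of degree d in residue r+1 vanishes for d
  -- = r+1.
  have hz : j = r + 1 → e = d → -4 * ((d : ℚ) - (r + 1)) ≠ 0 → d ≠ r + 1 := by
    rintro _ _ h1 rfl
    simp at h1
  simp only [coreWeight]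
  split_ifs at h <;> first | exact absurd rfl h | skip
  all_goals
    split_ifs <;> simp only [Prod.mk.injEq] <;> first | omega | (have := hz (by omega) (by omega) h; omega)

theorem matching_val (M : ℕ) (u : Fin (M + 2) × Fin M) :
    (((matching M u).1 : ℕ), ((matching M u).2 : ℕ)) = matchRow M (u.1, u.2) := rfl

theorem det_coreMatrix (M : ℕ) (hM : 2 ≤ M) (he : Even M) (c : ℚ) :
    (coreMatrix M c).det
      = -∏ d ∈ Finset.range (M + 2), ∏ r ∈ Finset.range M,
        coreEntry M c (matchRow M (d, r)).1 (matchRow M (d, r)).2 d r := by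
  rw [det_eq_sign_mul_prod _ (matching M) (fun v => coreWeight M (v.1, v.2)), sign_matching M hM he,
    Fintype.prod_prod_type]
  · rw [Units.val_neg, Units.val_one, Int.cast_neg, Int.cast_one, neg_one_mul,
      ← Fin.prod_univ_eq_prod_range (fun d => ∏ r ∈ Finset.range M,
        coreEntry M c (matchRow M (d, r)).1 (matchRow M (d, r)).2 d r)]
    congr 1
    refine Finset.prod_congr rfl fun d _ => ?_
    rw [← Fin.prod_univ_eq_prod_range (fun r =>
        coreEntry M c (matchRow M (d, r)).1 (matchRow M (d, r)).2 d r)]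
    rfl
  · intro e u h
    have := coreEntry_weight e.1.2 e.2.2 u.1.2 u.2.2 h
    rw [← matching_val] at this
    refine this.imp (fun h' => ?_) id
    simp only [Prod.mk.injEq] at h'
    exact Prod.ext (Fin.ext h'.1) (Fin.ext h'.2)

/-! ### Cancellation of the factorials and reduction to the core determinant. -/

theorem prod_newtonValues_row (M : ℕ) (c : ℚ) (r : ℕ) :
    ∏ t ∈ Finset.range (M + 2), c⁻¹ ^ t * (t.factorial : ℚ)
      = c⁻¹ ^ (M + 1) * ((M + 1).factorial : ℚ)
        * ∏ t ∈ Finset.range (M + 2),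
          (if IsS M t r then 1 else rowFactor M c t r) * if IsS M t r then 1 else (t.factorial : ℚ) := by
  have hS1 : IsS M (M + 1) r := Or.inl le_rfl
  by_cases h : r + 1 = M
  · have hS0 : IsS M M r := Or.inr ⟨rfl, h⟩
    rw [Finset.prod_range_succ, Finset.prod_range_succ', Finset.prod_range_succ (n := M + 1),
      Finset.prod_range_succ (n := M), if_pos hS1, if_pos hS1, if_pos hS0, if_pos hS0]
    -- In the last residue the values are taken at t+1, so the row factor t+1 raises t! to (t+1)!.
    -- The product thus covers the arguments 1, ..., M, the argument 0 contributes 1, and again only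
    -- M+1 is missing.
    have e : ∏ t ∈ Finset.range M, (c⁻¹ ^ (t + 1) * ((t + 1).factorial : ℚ))
        = ∏ t ∈ Finset.range M, (if IsS M t r then 1 else rowFactor M c t r)
          * if IsS M t r then 1 else (t.factorial : ℚ) := by
      refine Finset.prod_congr rfl fun t ht => ?_
      rw [Finset.mem_range] at ht
      have hS : ¬ IsS M t r := by simp only [IsS]; omega
      rw [if_neg hS, if_neg hS, rowFactor, if_pos h, Nat.factorial_succ]
      push_cast
      ring
    rw [e]
    simp
    ring
  · rw [Finset.prod_range_succ, Finset.prod_range_succ (n := M + 1), if_pos hS1, if_pos hS1]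
    have e : ∏ t ∈ Finset.range (M + 1), (c⁻¹ ^ t * (t.factorial : ℚ))
        = ∏ t ∈ Finset.range (M + 1), (if IsS M t r then 1 else rowFactor M c t r)
          * if IsS M t r then 1 else (t.factorial : ℚ) := by
      refine Finset.prod_congr rfl fun t ht => ?_
      rw [Finset.mem_range] at ht
      have hS : ¬ IsS M t r := by simp only [IsS]; omega
      rw [if_neg hS, if_neg hS, rowFactor, if_neg h]
    rw [e]
    ring

theorem det_newtonValues_eq (M : ℕ) (c : ℚ) :
    (newtonValues M c).det = (c⁻¹ ^ (M + 1) * ((M + 1).factorial : ℚ)) ^ M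
      * ((pascalMatrix M c).det * (diffMatrix M).det) := by
  rw [det_newtonValues, det_pascalMatrix, det_diffMatrix, ← Finset.prod_mul_distrib,
    Fintype.prod_prod_type, Finset.prod_comm,
    Fin.prod_univ_eq_prod_range (fun r => ∏ d : Fin (M + 2),
      ((if IsS M d r then 1 else rowFactor M c d r)
        * if IsS M d r then 1 else ((d : ℕ).factorial : ℚ))) M]
  have hpow : ∀ x : ℚ, x ^ M = ∏ _r ∈ Finset.range M, x := fun x => by
    rw [Finset.prod_const, Finset.card_range]
  rw [hpow, hpow, ← Finset.prod_mul_distrib]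
  refine Finset.prod_congr rfl fun r _ => ?_
  rw [prod_newtonValues_row M c r, Fin.prod_univ_eq_prod_range (fun d =>
      ((if IsS M d r then 1 else rowFactor M c d r)
        * if IsS M d r then 1 else (d.factorial : ℚ)))]

theorem det_pascalMatrix_mul_ne_zero (M : ℕ) {c : ℚ} (hc : c ≠ 0) :
    (pascalMatrix M c).det * (diffMatrix M).det ≠ 0 := by
  rw [det_pascalMatrix, det_diffMatrix]
  refine mul_ne_zero (Finset.prod_ne_zero_iff.mpr fun u _ => ?_)
    (Finset.prod_ne_zero_iff.mpr fun u _ => ?_)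
  · split_ifs
    · exact one_ne_zero
    · rw [rowFactor]
      split_ifs
      · exact mul_ne_zero (pow_ne_zero _ (inv_ne_zero hc)) (by positivity)
      · exact pow_ne_zero _ (inv_ne_zero hc)
  · split_ifs
    · exact one_ne_zero
    · positivity

theorem det_A_eq (k : ℕ) (hk : 1 ≤ k) :
    (A k).det = -((-4) ^ k) ^ (2 * (4 * k) ^ 2 + 4 * (4 * k) + 1)
      * ((((-4) ^ k)⁻¹) ^ (4 * k + 1) * ((4 * k + 1).factorial : ℚ)) ^ (4 * k)
      * (coreMatrix (4 * k) ((-4) ^ k)).det := by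
  have h := det_A_mul k hk
  have hc : ((-4 : ℚ) ^ k) ≠ 0 := by positivity
  rw [valMatrix_eq, imMatrix_eq k hk, Matrix.det_mul, Matrix.det_mul, det_newtonValues_eq] at h
  have hv := det_pascalMatrix_mul_ne_zero (4 * k) hc
  generalize (-4 : ℚ) ^ k = c at *
  have hN : 1 ≤ N k := Nat.mul_pos (by omega) (by omega)
  have he : ((-c) ^ (4 * k + 2)) ^ (N k + 4 * k)
      = ((-c) ^ (4 * k + 1)) ^ (N k - 1) * (-c ^ (2 * (4 * k) ^ 2 + 4 * (4 * k) + 1)) := by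
    have ho : Odd (2 * (4 * k) ^ 2 + 4 * (4 * k) + 1) := ⟨(4 * k) ^ 2 + 2 * (4 * k), by ring⟩
    rw [← ho.neg_pow, ← pow_mul, ← pow_mul, ← pow_add]
    congr 1
    obtain ⟨n, hn⟩ : ∃ n, N k = n + 1 := ⟨N k - 1, by omega⟩
    have hn' : n + 1 = 4 * k * (4 * k + 1) := by rw [← hn, N]
    rw [hn, Nat.add_sub_cancel]
    zify at hn' ⊢
    linear_combination hn'
  rw [he] at h
  refine mul_right_cancel₀ hv (mul_left_cancel₀
    (pow_ne_zero (N k - 1) (pow_ne_zero (4 * k + 1) (neg_ne_zero.mpr hc))) ?_)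
  linear_combination h

/-! ### Evaluation in closed form. -/

/-- The product of the first `n` odd numbers. -/
def oddProd (n : ℕ) : ℚ := ∏ i ∈ Finset.range n, (2 * (i : ℚ) + 1)

theorem factorial_two_mul (n : ℕ) :
    ((2 * n).factorial : ℚ) / (n.factorial : ℚ) = 2 ^ n * oddProd n := by
  rw [div_eq_iff (by positivity)]
  induction n with
  | zero => simp [oddProd]
  | succ n ih =>
    rw [mul_add, mul_one, Nat.factorial_succ, Nat.factorial_succ, Nat.factorial_succ n, oddProd,
      Finset.prod_range_succ, ← oddProd]
    push_cast
    rw [ih]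
    ring

theorem prod_range_const_mul (n : ℕ) (b : ℚ) (f : ℕ → ℚ) :
    ∏ i ∈ Finset.range n, b * f i = b ^ n * ∏ i ∈ Finset.range n, f i := by
  rw [Finset.prod_mul_distrib, Finset.prod_const, Finset.card_range]

theorem prod_coreEntry_row {M : ℕ} (c : ℚ) {r : ℕ} (hr : r + 1 < M) :
    ∏ d ∈ Finset.range (M + 2), coreEntry M c (matchRow M (d, r)).1 (matchRow M (d, r)).2 d r
      = (-1 / 2) ^ (r + 1) * oddProd (r + 1) * (4 * M) ^ (M - r) * -(2 * M) := by
  have hsplit : M + 1 = (r + 1) + (M - r) := by omega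
  have hrM : r + 1 ≠ M := by omega
  have e1 : ∏ d ∈ Finset.range (r + 1),
      coreEntry M c (matchRow M (d, r)).1 (matchRow M (d, r)).2 d r
        = (-1 / 2) ^ (r + 1) * oddProd (r + 1) := by
    rw [oddProd, ← prod_range_const_mul, ← Finset.prod_range_reflect]
    refine Finset.prod_congr rfl fun d hd => ?_
    rw [Finset.mem_range] at hd
    have hS : ¬ IsS M (r + 1 - 1 - d) r := by simp only [IsS]; omega
    have hle : r + 1 - 1 - d ≤ r := by omega
    simp only [matchRow, coreEntry, if_neg hS, if_pos hle, if_neg hrM, if_true]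
    rw [if_neg (by omega), Nat.add_sub_cancel, Nat.cast_sub (by omega)]
    ring
  have e2 : ∏ i ∈ Finset.range (M - r), coreEntry M c (matchRow M (r + 1 + i, r)).1
      (matchRow M (r + 1 + i, r)).2 (r + 1 + i) r = (4 * M) ^ (M - r) := by
    rw [← Finset.card_range (M - r), ← Finset.prod_const, Finset.card_range]
    refine Finset.prod_congr rfl fun i hi => ?_
    rw [Finset.mem_range] at hi
    have hS : ¬ IsS M (r + 1 + i) r := by simp only [IsS]; omega
    have hle : ¬ r + 1 + i ≤ r := by omega
    simp [matchRow, coreEntry, hS, hle, hrM]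
  have hS : IsS M (M + 1) r := Or.inl le_rfl
  rw [Finset.prod_range_succ, hsplit, Finset.prod_range_add, e1, e2, ← hsplit]
  simp [matchRow, coreEntry, hS]

theorem prod_coreEntry_last {M : ℕ} (hM : 1 ≤ M) (c : ℚ) :
    ∏ d ∈ Finset.range (M + 2),
        coreEntry M c (matchRow M (d, M - 1)).1 (matchRow M (d, M - 1)).2 d (M - 1)
      = (-(c⁻¹ * M) / (2 * M) ^ 2) ^ M * oddProd M ^ 2 * (4 * M ^ 2) := by
  have hM0 : (M : ℚ) ≠ 0 := by positivity
  have hrM : M - 1 + 1 = M := by omega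
  have e1 : ∏ d ∈ Finset.range M,
      coreEntry M c (matchRow M (d, M - 1)).1 (matchRow M (d, M - 1)).2 d (M - 1)
        = (-(c⁻¹ * M) / (2 * M) ^ 2) ^ M * oddProd M ^ 2 := by
    rw [oddProd, ← Finset.prod_pow, ← prod_range_const_mul, ← Finset.prod_range_reflect]
    refine Finset.prod_congr rfl fun d hd => ?_
    rw [Finset.mem_range] at hd
    have hS : ¬ IsS M (M - 1 - d) (M - 1) := by simp only [IsS]; omega
    have hle : M - 1 - d ≤ M - 1 := by omega
    have hcast : ((M - 1 - d : ℕ) : ℚ) = M - 1 - d := by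
      rw [Nat.cast_sub (by omega), Nat.cast_sub hM, Nat.cast_one]
    simp only [matchRow, coreEntry, if_neg hS, if_pos hle, if_pos hrM, if_true]
    rw [if_neg (by omega), if_neg (by omega), hcast]
    field_simp
    ring
  have hS1 : IsS M (M + 1) (M - 1) := Or.inl le_rfl
  have hS0 : IsS M M (M - 1) := Or.inr ⟨rfl, hrM⟩
  rw [Finset.prod_range_succ, Finset.prod_range_succ, e1]
  simp [matchRow, coreEntry, hS0, hS1]
  ring

theorem prod_range_pow_succ (b : ℚ) (n : ℕ) :
    ∏ r ∈ Finset.range (4 * n + 3), b ^ (r + 1) = b ^ ((4 * n + 3) * (2 * n + 2)) := by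
  rw [Finset.prod_pow_eq_pow_sum]
  congr 1
  have h : ∀ m, 2 * ∑ r ∈ Finset.range m, (r + 1) = m * (m + 1) := by
    intro m
    induction m with
    | zero => rfl
    | succ m ih => rw [Finset.sum_range_succ, mul_add, ih]; ring
  have h' := h (4 * n + 3)
  have e : (4 * n + 3) * (4 * n + 3 + 1) = 2 * ((4 * n + 3) * (2 * n + 2)) := by ring
  omega

theorem prod_factorial_ratio (m : ℕ) :
    ∏ j ∈ Finset.Icc 1 m, ((2 * j).factorial : ℚ) / (j.factorial : ℚ)
      = ∏ r ∈ Finset.range m, 2 ^ (r + 1) * oddProd (r + 1) := by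
  induction m with
  | zero => simp
  | succ m ih =>
    rw [Finset.prod_Icc_succ_top (by omega), ih, Finset.prod_range_succ, factorial_two_mul]

/-- The two factors on the left avoid divisions: (-32(n+1))^(r+1) turns (-1/2)^(r+1) (4M)^(M-r) into
(4M)^(M+1), independently of r, and 16(n+1) = 4M reduces each of the factors in the last residue to
-c⁻¹ times odd squares. The sign of the matching cancels against the odd number M-1 of factors -2M.
-/
theorem det_coreMatrix_eq (n : ℕ) (c : ℚ) :
    (coreMatrix (4 * (n + 1)) c).det * (32 * ((n : ℚ) + 1)) ^ ((4 * n + 3) * (2 * n + 2))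
        * (16 * ((n : ℚ) + 1)) ^ (4 * n + 4)
      = (8 * ((n : ℚ) + 1) * (16 * ((n : ℚ) + 1)) ^ (4 * n + 5)) ^ (4 * n + 3)
        * c⁻¹ ^ (4 * n + 4) * (64 * ((n : ℚ) + 1) ^ 2)
        * (∏ r ∈ Finset.range (4 * (n + 1)), oddProd (r + 1)) * oddProd (4 * (n + 1)) := by
  have hM : 4 * (n + 1) = 4 * n + 3 + 1 := by ring
  have hMc : ((4 * (n + 1) : ℕ) : ℚ) = 4 * (n + 1) := by push_cast; ring
  have hm : (n : ℚ) + 1 ≠ 0 := by positivity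
  rw [det_coreMatrix _ (by omega) ⟨2 * (n + 1), by ring⟩, Finset.prod_comm]
  have hlast := prod_coreEntry_last (M := 4 * (n + 1)) (by omega) c
  have hrow : (∏ r ∈ Finset.range (4 * n + 3), ∏ d ∈ Finset.range (4 * (n + 1) + 2),
      coreEntry (4 * (n + 1)) c (matchRow (4 * (n + 1)) (d, r)).1
        (matchRow (4 * (n + 1)) (d, r)).2 d r)
        * (32 * ((n : ℚ) + 1)) ^ ((4 * n + 3) * (2 * n + 2))
      = -(8 * ((n : ℚ) + 1) * (16 * ((n : ℚ) + 1)) ^ (4 * n + 5)) ^ (4 * n + 3)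
        * ∏ r ∈ Finset.range (4 * n + 3), oddProd (r + 1) := by
    have hodd : Odd (4 * n + 3) := ⟨2 * n + 1, by ring⟩
    have heven : Even ((4 * n + 3) * (2 * n + 2)) := ⟨(4 * n + 3) * (n + 1), by ring⟩
    rw [← hodd.neg_pow, ← heven.neg_pow, ← prod_range_pow_succ, ← Finset.prod_mul_distrib,
      ← prod_range_const_mul]
    refine Finset.prod_congr rfl fun r hr => ?_
    rw [Finset.mem_range] at hr
    rw [prod_coreEntry_row c (by omega), hMc]
    have e1 : (-(32 * ((n : ℚ) + 1))) ^ (r + 1)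
        = (-2) ^ (r + 1) * (16 * ((n : ℚ) + 1)) ^ (r + 1) := by
      rw [← mul_pow]; ring
    have e2 : ((-1 : ℚ) / 2) ^ (r + 1) * (-2) ^ (r + 1) = 1 := by
      rw [← mul_pow]; norm_num
    have e3 : (16 * ((n : ℚ) + 1)) ^ (4 * (n + 1) - r) * (16 * ((n : ℚ) + 1)) ^ (r + 1)
        = (16 * ((n : ℚ) + 1)) ^ (4 * n + 5) := by
      rw [← pow_add]; congr 1; omega
    rw [e1, ← e3]
    linear_combination (oddProd (r + 1) * (16 * ((n : ℚ) + 1)) ^ (4 * (n + 1) - r)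
      * -(8 * ((n : ℚ) + 1)) * (16 * ((n : ℚ) + 1)) ^ (r + 1)) * e2
  have hfac : (-(c⁻¹ * (4 * ((n : ℚ) + 1))) / (2 * (4 * (n + 1))) ^ 2) ^ (4 * (n + 1))
      * (16 * ((n : ℚ) + 1)) ^ (4 * n + 4) = c⁻¹ ^ (4 * n + 4) := by
    have heven : Even (4 * n + 4) := ⟨2 * n + 2, by ring⟩
    rw [mul_add 4 n 1, mul_one, ← mul_pow, ← heven.neg_pow c⁻¹]
    congr 1
    field_simp
    ring
  rw [hMc] at hlast
  have hidx : 4 * (n + 1) - 1 = 4 * n + 3 := by omega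
  rw [hidx] at hlast
  rw [Finset.prod_congr (show Finset.range (4 * (n + 1)) = Finset.range (4 * n + 3 + 1) by rw [hM])
    (fun _ _ => rfl), Finset.prod_range_succ, hlast,
    Finset.prod_congr (show Finset.range (4 * (n + 1)) = Finset.range (4 * n + 3 + 1) by rw [hM])
    (fun _ _ => rfl), Finset.prod_range_succ (fun r => oddProd (r + 1)), ← hM]
  set a := ∏ r ∈ Finset.range (4 * n + 3), ∏ d ∈ Finset.range (4 * (n + 1) + 2),
      coreEntry (4 * (n + 1)) c (matchRow (4 * (n + 1)) (d, r)).1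
        (matchRow (4 * (n + 1)) (d, r)).2 d r
  rw [show 4 * n + 4 = 4 * (n + 1) by ring] at hfac
  rw [← hfac]
  linear_combination (-(-(c⁻¹ * (4 * ((n : ℚ) + 1))) / (2 * (4 * (n + 1))) ^ 2) ^ (4 * (n + 1))
      * (16 * ((n : ℚ) + 1)) ^ (4 * (n + 1)) * oddProd (4 * (n + 1)) ^ 2
      * (4 * (4 * ((n : ℚ) + 1)) ^ 2)) * hrow

/-- The bookkeeping of the powers of 2. With an indeterminate x in place of 2 the claim is an
identity between exponents. -/
theorem collect_powers (x m : ℚ) (n : ℕ) :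
    x ^ (2 * (n + 1) * (4 * n + 5) ^ 2)
        * (x ^ 3 * m * (x ^ 4 * m) ^ (4 * n + 5)) ^ (4 * n + 3) * (x ^ 6 * m ^ 2)
      = x ^ (32 * n ^ 3 + 128 * n ^ 2 + 162 * n + 65) * m ^ (8 * (n + 1) ^ 2 + 2 * (n + 1))
        * x ^ (4 * n + 4) * (x ^ ((4 * n + 3) * (2 * n + 2)) * x ^ (4 * n + 4))
        * (x ^ 5 * m) ^ ((4 * n + 3) * (2 * n + 2)) * (x ^ 4 * m) ^ (4 * n + 4) := by
  simp only [mul_pow, ← pow_mul, ← pow_add]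
  ring

theorem det_A_formula (n : ℕ) :
    (A (n + 1)).det
      = (-1) ^ n * 2 ^ (32 * n ^ 3 + 128 * n ^ 2 + 162 * n + 65)
        * ((n : ℚ) + 1) ^ (8 * (n + 1) ^ 2 + 2 * (n + 1))
        * ((4 * (n + 1) + 1).factorial : ℚ) ^ (4 * (n + 1))
        * (((8 * (n + 1)).factorial : ℚ) / ((4 * (n + 1)).factorial : ℚ))
        * ∏ j ∈ Finset.Icc 1 (4 * (n + 1)), ((2 * j).factorial : ℚ) / (j.factorial : ℚ) := by
  have hcore := det_coreMatrix_eq n ((-4) ^ (n + 1))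
  have hpow := collect_powers 2 ((n : ℚ) + 1) n
  have h8 : 8 * (n + 1) = 2 * (4 * (n + 1)) := by ring
  have hc : ((-4 : ℚ) ^ (n + 1)) ≠ 0 := by positivity
  have hcpow : ((-4 : ℚ) ^ (n + 1)) ^ (2 * (4 * (n + 1)) ^ 2 + 4 * (4 * (n + 1)) + 1)
      * (((-4) ^ (n + 1))⁻¹) ^ ((4 * (n + 1) + 1) * (4 * (n + 1))) * (((-4) ^ (n + 1))⁻¹) ^ (4 * n + 4)
      = -(-1) ^ n * 2 ^ (2 * (n + 1) * (4 * n + 5) ^ 2) := by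
    -- The exponent is split as (M+1)² + M(M+1) + M. The last two parts cancel the inverse powers,
    -- and the odd square leaves the sign (-1)^(n+1).
    have e : 2 * (4 * (n + 1)) ^ 2 + 4 * (4 * (n + 1)) + 1
        = (4 * n + 5) ^ 2 + ((4 * (n + 1) + 1) * (4 * (n + 1)) + (4 * n + 4)) := by ring
    have hcancel : ∀ (c : ℚ) (a b d : ℕ), c ≠ 0 →
        c ^ (a + (b + d)) * c⁻¹ ^ b * c⁻¹ ^ d = c ^ a := by
      intro c a b d h
      rw [pow_add, pow_add, inv_pow, inv_pow]
      field_simp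
    rw [e, hcancel _ _ _ _ hc, ← pow_mul]
    have e4 : (-4 : ℚ) = (-1) * 2 ^ 2 := by norm_num
    rw [e4, mul_pow, ← pow_mul, ← mul_assoc 2, pow_mul (-1), pow_succ (-1) n, mul_pow]
    have ho : Odd ((4 * n + 5) ^ 2) := Odd.pow ⟨2 * n + 2, by ring⟩
    rw [ho.neg_one_pow, ← pow_mul, mul_comm n, pow_mul, ho.neg_one_pow]
    ring
  have hO : ∏ r ∈ Finset.range (4 * (n + 1)), (2 : ℚ) ^ (r + 1) * oddProd (r + 1)
      = 2 ^ ((4 * n + 3) * (2 * n + 2)) * 2 ^ (4 * n + 4)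
        * ∏ r ∈ Finset.range (4 * (n + 1)), oddProd (r + 1) := by
    rw [Finset.prod_mul_distrib, ← prod_range_pow_succ,
      ← Finset.prod_range_succ (fun r => (2 : ℚ) ^ (r + 1))]
    rfl
  rw [h8, factorial_two_mul, prod_factorial_ratio, hO, det_A_eq _ (by omega), mul_pow _ _ (4 * (n + 1)),
    ← pow_mul (((-4) ^ (n + 1))⁻¹)]
  have hne : (32 * ((n : ℚ) + 1)) ^ ((4 * n + 3) * (2 * n + 2))
        * (16 * ((n : ℚ) + 1)) ^ (4 * n + 4) ≠ 0 := by positivity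
  refine mul_right_cancel₀ hne ?_
  have e3 : (2 : ℚ) ^ 3 = 8 := by norm_num
  have e4 : (2 : ℚ) ^ 4 = 16 := by norm_num
  have e5 : (2 : ℚ) ^ 5 = 32 := by norm_num
  have e6 : (2 : ℚ) ^ 6 = 64 := by norm_num
  rw [e3, e4, e5, e6] at hpow
  generalize (∏ r ∈ Finset.range (4 * (n + 1)), oddProd (r + 1)) = p at *
  generalize oddProd (4 * (n + 1)) = o at *
  generalize ((4 * (n + 1) + 1).factorial : ℚ) ^ (4 * (n + 1)) = f at *
  have e2 : (2 : ℚ) ^ (4 * (n + 1)) = 2 ^ (4 * n + 4) := by rw [mul_add, mul_one]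
  rw [e2]
  generalize (-4 : ℚ) ^ (n + 1) = c at *
  generalize (coreMatrix (4 * (n + 1)) c).det = D at *
  generalize (32 * ((n : ℚ) + 1)) ^ ((4 * n + 3) * (2 * n + 2)) = u at *
  generalize (16 * ((n : ℚ) + 1)) ^ (4 * n + 4) = v at *
  generalize (8 * ((n : ℚ) + 1) * (16 * ((n : ℚ) + 1)) ^ (4 * n + 5)) ^ (4 * n + 3) = w at *
  generalize c ^ (2 * (4 * (n + 1)) ^ 2 + 4 * (4 * (n + 1)) + 1) = cX at *
  generalize c⁻¹ ^ ((4 * (n + 1) + 1) * (4 * (n + 1))) = cY at *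
  generalize c⁻¹ ^ (4 * n + 4) = cZ at *
  linear_combination (-cX * cY * f) * hcore - (f * w * (64 * ((n : ℚ) + 1) ^ 2) * p * o) * hcpow
    + ((-1) ^ n * f * p * o) * hpow

end PiFormula


theorem mainTheorem3 (k : ℕ) (hk : 1 ≤ k) :
    (PiFormula.A k).det
        = (-1) ^ (k - 1) * 2 ^ (32 * k ^ 3 + 32 * k ^ 2 + 2 * k - 1) * (k : ℚ) ^ (8 * k ^ 2 + 2 * k)
          * ((4 * k + 1).factorial : ℚ) ^ (4 * k)
          * (((8 * k).factorial : ℚ) / ((4 * k).factorial : ℚ))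
          * ∏ j ∈ Finset.Icc 1 (4 * k), ((2 * j).factorial : ℚ) / (j.factorial : ℚ)
      ∧ (PiFormula.A k).det ≠ 0 := by
  obtain ⟨n, rfl⟩ : ∃ n, k = n + 1 := ⟨k - 1, by omega⟩
  have h : (PiFormula.A (n + 1)).det
        = (-1) ^ (n + 1 - 1) * 2 ^ (32 * (n + 1) ^ 3 + 32 * (n + 1) ^ 2 + 2 * (n + 1) - 1)
          * ((n + 1 : ℕ) : ℚ) ^ (8 * (n + 1) ^ 2 + 2 * (n + 1))
          * ((4 * (n + 1) + 1).factorial : ℚ) ^ (4 * (n + 1))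
          * (((8 * (n + 1)).factorial : ℚ) / ((4 * (n + 1)).factorial : ℚ))
          * ∏ j ∈ Finset.Icc 1 (4 * (n + 1)), ((2 * j).factorial : ℚ) / (j.factorial : ℚ) := by
    have e : 32 * (n + 1) ^ 3 + 32 * (n + 1) ^ 2 + 2 * (n + 1) - 1
        = 32 * n ^ 3 + 128 * n ^ 2 + 162 * n + 65 := by
      have : 32 * (n + 1) ^ 3 + 32 * (n + 1) ^ 2 + 2 * (n + 1)
        = 32 * n ^ 3 + 128 * n ^ 2 + 162 * n + 65 + 1 := by ring
      omega
    rw [e, Nat.add_sub_cancel, PiFormula.det_A_formula n, Nat.cast_add, Nat.cast_one]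
  refine ⟨h, ?_⟩
  rw [h]
  have h1 : ∏ j ∈ Finset.Icc 1 (4 * (n + 1)), ((2 * j).factorial : ℚ) / (j.factorial : ℚ) ≠ 0 :=
    Finset.prod_ne_zero_iff.mpr fun j _ => by positivity
  have h2 : ((-1 : ℚ)) ^ (n + 1 - 1) ≠ 0 := pow_ne_zero _ (by norm_num)
  refine mul_ne_zero (mul_ne_zero (mul_ne_zero (mul_ne_zero (mul_ne_zero h2 ?_) ?_) ?_) ?_) h1 <;>
    positivity
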